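/- Let $n\ge1$, $0<s<1$, and let $\Omega\subset\mathbb R^n$ be a bounded open set with Lipschitz continuous boundary. Put $C_{n,s}=\frac{s2^{2s}\Gamma(\frac{2s+n}{2})}{\pi^{n/2}\Gamma(1-s)}$, and let $\beta\in L^1(\mathbb R^n\setminus\Omega)$ with $\beta\ge0$ (a.e.). Let $W^{s,2}_{\beta,\Omega}$ be the space of measurable $u:\mathbb R^n\to\mathbb R$ with $$\int_\Omega|u|^2dx+\int_{\mathbb R^n\setminus\Omega}|u|^2|\beta|\,dx+\int_{\mathbb R^{2n}\setminus(\mathbb R^n\setminus\Omega)^2}\frac{|u(x)-u(y)|^2}{|x-y|^{n+2s}}\,dx\,dy<\infty ,$$ and for $u,v\in W^{s,2}_{\beta,\Omega}$ let $$\mathcal E(u,v)=\frac{C_{n,s}}2\int_\Omega\int_\Omega\frac{(u(x)-u(y))(v(x)-v(y))}{|x-y|^{n+2s}}\,dy\,dx+C_{n,s}\int_\Omega\int_{\mathbb R^n\setminus\Omega}\frac{(u(x)-u(y))(v(x)-v(y))}{|x-y|^{n+2s}}\,dy\,dx .$$ For $x\in\mathbb R^n\setminus\overline\Omega$ let $\rho(x)=\int_\Omega|x-y|^{-n-2s}dy$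 and $\mathcal N^su(x)=C_{n,s}\int_\Omega\frac{u(x)-u(y)}{|x-y|^{n+2s}}dy$. For $u\in L^2(\Omega)$ define its Robin extension (up to null sets) by $u_R=u$ in $\Omega$ and $$u_R(x)=\frac{C_{n,s}}{C_{n,s}\rho(x)+\beta(x)}\int_\Omega\frac{u(y)}{|x-y|^{n+2s}}\,dy,\qquad x\in\mathbb R^n\setminus\overline\Omega .$$ For $f\in L^2(\Omega)$, a weak solution of $$(-\Delta)^sw=f\ \text{ in }\Omega,\qquad \mathcal N^sw+\beta w=0\ \text{ in }\mathbb R^n\setminus\overline\Omega \tag{1}$$ is a function $w\in W^{s,2}_{\beta,\Omega}$ such that $\mathcal E(w,v)+\int_{\mathbb R^n\setminus\Omega}\beta wv\,dx=\int_\Omega fv\,dx$ for all $v\in W^{s,2}_{\beta,\Omega}$. Let $D(\mathfrak a_R)=\{u\in L^2(\Omega):u_R\in W^{s,2}_{\beta,\Omega}\}$ and $$\mathfrak a_R(u,v)=\mathcal E(u_R,v_R)+\int_{\mathbb R^n\setminus\Omega}\beta u_Rv_R\,dx,\qquad u,v\in D(\mathfrak a_R).$$ Then $D(\mathfrak a_R)$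 is a linear subspace and $\mathfrak a_R$ is a closed, symmetric, non-negative and densely defined bilinear form on $L^2(\Omega)$; here closed means that, for every $\lambda>0$, every sequence in $D(\mathfrak a_R)$ that is Cauchy for $\mathfrak a_R(u,u)+\lambda\|u\|_{L^2(\Omega)}^2$ converges to an element of $D(\mathfrak a_R)$ with respect to it. For every $u\in L^2(\Omega)$ the nonlocal Robin exterior condition $\mathcal N^su_R+\beta u_R=0$ holds a.e. in $\mathbb R^n\setminus\overline\Omega$. The operator $A_R$ associated with $\mathfrak a_R$ (that is, $u\in D(A_R)$ and $A_Ru=f$ if and only if $u\in D(\mathfrak a_R)$, $f\in L^2(\Omega)$ and $\mathfrak a_R(u,v)=(f,v)_{L^2(\Omega)}$ for all $v\in D(\mathfrak a_R)$) is a well-defined selfadjoint operator on $L^2(\Omega)$, and it is given by $$D(A_R)=\{u\in L^2(\Omega):u_R\in W^{s,2}_{\beta,\Omega}\text{ and there is }f\in L^2(\Omega)\text{ such that }u_R\text{ is a weak solution of (1)}\},\qquad A_Ru=f .$$ -/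

import Mathlib

open MeasureTheory Filter Topology

namespace NonlocalRobin

noncomputable section

/-- The bounded open sets with Lipschitz boundary are those satisfying this predicate in addition to
being bounded and open: near each boundary point `z`, in the direction of some unit vector `e`, the
set lies strictly above the graph of a Lipschitz function of the component orthogonal to `e`. -/
def HasLipschitzBoundary {n : ℕ} (Ω : Set (EuclideanSpace ℝ (Fin n))) : Prop :=
  ∀ z ∈ frontier Ω, ∃ (r : ℝ) (e : EuclideanSpace ℝ (Fin n)) (K : NNReal)
    (γ : EuclideanSpace ℝ (Fin n) → ℝ),
    0 < r ∧ ‖e‖ = 1 ∧ LipschitzWith K γ ∧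
      ∀ x ∈ Metric.ball z r, x ∈ Ω ↔ γ (x - inner ℝ e x • e) < inner ℝ e x

/-- The space `L²(Ω)`, with respect to Lebesgue measure. -/
abbrev L2 {n : ℕ} (Ω : Set (EuclideanSpace ℝ (Fin n))) : Type :=
  Lp ℝ 2 ((volume : Measure (EuclideanSpace ℝ (Fin n))).restrict Ω)

/-- The normalization constant `C_{n,s}` of the fractional Laplacian. -/
def fracConst (n : ℕ) (s : ℝ) : ℝ :=
  s * (2 : ℝ) ^ (2 * s) * Real.Gamma ((2 * s + n) / 2) /
    (Real.pi ^ ((n : ℝ) / 2) * Real.Gamma (1 - s))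

/-- The set `ℝ²ⁿ \ (ℝⁿ \ Ω)²` of pairs of points at least one of which is in `Ω`. -/
def crossSet {n : ℕ} (Ω : Set (EuclideanSpace ℝ (Fin n))) :
    Set (EuclideanSpace ℝ (Fin n) × EuclideanSpace ℝ (Fin n)) :=
  (Ωᶜ ×ˢ Ωᶜ)ᶜ

/-- The square of the norm of `W^{s,2}_{β,Ω}`, as an extended nonnegative number. -/
def sobolevNormSq {n : ℕ} (s : ℝ) (Ω : Set (EuclideanSpace ℝ (Fin n)))
    (β u : EuclideanSpace ℝ (Fin n) → ℝ) : ENNReal :=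
  (∫⁻ x in Ω, ENNReal.ofReal (|u x| ^ 2)) +
    (∫⁻ x in Ωᶜ, ENNReal.ofReal (|u x| ^ 2 * |β x|)) +
    ∫⁻ p in crossSet Ω,
      ENNReal.ofReal (|u p.1 - u p.2| ^ 2 / ‖p.1 - p.2‖ ^ ((n : ℝ) + 2 * s))

/-- Membership of a function on `ℝⁿ` in `W^{s,2}_{β,Ω}`: Lebesgue measurable with finite norm. -/
def MemW {n : ℕ} (s : ℝ) (Ω : Set (EuclideanSpace ℝ (Fin n)))
    (β u : EuclideanSpace ℝ (Fin n) → ℝ) : Prop :=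
  AEMeasurable u volume ∧ sobolevNormSq s Ω β u < ⊤

/-- The energy `ℰ(u, v)`. -/
def energy {n : ℕ} (s : ℝ) (Ω : Set (EuclideanSpace ℝ (Fin n)))
    (u v : EuclideanSpace ℝ (Fin n) → ℝ) : ℝ :=
  fracConst n s / 2 *
      (∫ x in Ω, ∫ y in Ω, (u x - u y) * (v x - v y) / ‖x - y‖ ^ ((n : ℝ) + 2 * s)) +
    fracConst n s *
      (∫ x in Ω, ∫ y in Ωᶜ, (u x - u y) * (v x - v y) / ‖x - y‖ ^ ((n : ℝ) + 2 * s))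

/-- `ℰ(u, v) + ∫_{ℝⁿ \ Ω} β u v`. -/
def robinEnergy {n : ℕ} (s : ℝ) (Ω : Set (EuclideanSpace ℝ (Fin n)))
    (β u v : EuclideanSpace ℝ (Fin n) → ℝ) : ℝ :=
  energy s Ω u v + ∫ x in Ωᶜ, β x * u x * v x

/-- The weight `ρ(x) = ∫_Ω |x - y|^{-(n+2s)} dy`, for `x` outside the closure of `Ω`. -/
def rho {n : ℕ} (s : ℝ) (Ω : Set (EuclideanSpace ℝ (Fin n))) (x : EuclideanSpace ℝ (Fin n)) : ℝ :=
  ∫ y in Ω, 1 / ‖x - y‖ ^ ((n : ℝ) + 2 * s)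

/-- The nonlocal normal derivative `𝒩ˢ u`, for `x` outside the closure of `Ω`. -/
def nonlocalNormalDeriv {n : ℕ} (s : ℝ) (Ω : Set (EuclideanSpace ℝ (Fin n)))
    (u : EuclideanSpace ℝ (Fin n) → ℝ) (x : EuclideanSpace ℝ (Fin n)) : ℝ :=
  fracConst n s * ∫ y in Ω, (u x - u y) / ‖x - y‖ ^ ((n : ℝ) + 2 * s)

open Classical in
/-- The Robin extension `u_R` of a function on `Ω`. It matters only up to null sets; the values
on the (null) boundary of `Ω` are irrelevant. -/
def robinExt {n : ℕ} (s : ℝ) (Ω : Set (EuclideanSpace ℝ (Fin n)))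
    (β u : EuclideanSpace ℝ (Fin n) → ℝ) (x : EuclideanSpace ℝ (Fin n)) : ℝ :=
  if x ∈ Ω then u x
  else fracConst n s / (fracConst n s * rho s Ω x + β x) *
    ∫ y in Ω, u y / ‖x - y‖ ^ ((n : ℝ) + 2 * s)

/-- `u` is a weak solution of `(-Δ)ˢ u = f` in `Ω`, `𝒩ˢ u + β u = 0` in `ℝⁿ \ closure Ω`. -/
def IsWeakRobinSolution {n : ℕ} (s : ℝ) (Ω : Set (EuclideanSpace ℝ (Fin n)))
    (β : EuclideanSpace ℝ (Fin n) → ℝ) (f : L2 Ω) (u : EuclideanSpace ℝ (Fin n) → ℝ) : Prop :=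
  MemW s Ω β u ∧
    ∀ v : EuclideanSpace ℝ (Fin n) → ℝ, MemW s Ω β v →
      robinEnergy s Ω β u v = ∫ x in Ω, f x * v x

/-- A bilinear form with domain `D` in a Hilbert space is closed: for each `lam > 0`, sequences that
are Cauchy for `a + lam (·,·)` converge for `a + lam (·,·)` to an element of `D`. -/
def IsClosedForm {H : Type*} [NormedAddCommGroup H] [InnerProductSpace ℝ H]
    (D : Submodule ℝ H) (a : LinearMap.BilinForm ℝ D) : Prop :=
  ∀ lam : ℝ, 0 < lam → ∀ u : ℕ → D,
    Tendsto (fun p : ℕ × ℕ =>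
      a (u p.1 - u p.2) (u p.1 - u p.2) + lam * inner ℝ (u p.1 - u p.2) (u p.1 - u p.2))
      atTop (𝓝 0) →
    ∃ w : D, Tendsto (fun k => a (u k - w) (u k - w) + lam * inner ℝ (u k - w) (u k - w))
      atTop (𝓝 0)

/-- `A` is the operator associated with the form `a` with domain `D`: `u ∈ D(A)` and `A u = f` iff
`u ∈ D` and `a(u, v) = (f, v)` for all `v ∈ D`. -/
def IsAssociatedOperator {H : Type*} [NormedAddCommGroup H] [InnerProductSpace ℝ H]
    (D : Submodule ℝ H) (a : LinearMap.BilinForm ℝ D) (A : H →ₗ.[ℝ] H) : Prop :=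
  ∀ u f : H, (u, f) ∈ A.graph ↔ ∃ hu : u ∈ D, ∀ v : D, a ⟨u, hu⟩ v = inner ℝ f (v : H)

/-- The integral in the definition of the Robin extension converges off the closure of `Ω`. -/
theorem integrableOn_kernel_mul {n : ℕ} {s : ℝ} (hs : 0 < s)
    {Ω : Set (EuclideanSpace ℝ (Fin n))} (hb : Bornology.IsBounded Ω) (u : L2 Ω)
    {x : EuclideanSpace ℝ (Fin n)} (hx : x ∉ closure Ω) :
    IntegrableOn (fun y => u y / ‖x - y‖ ^ ((n : ℝ) + 2 * s)) Ω := by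
  have hfin : IsFiniteMeasure ((volume : Measure (EuclideanSpace ℝ (Fin n))).restrict Ω) :=
    ⟨by simpa using hb.measure_lt_top⟩
  have hu : Integrable u (volume.restrict Ω) := (Lp.memLp u).integrable (by norm_num)
  obtain ⟨d, hd, hball⟩ := Metric.isOpen_iff.1 isClosed_closure.isOpen_compl x hx
  have hm : Measurable fun y : EuclideanSpace ℝ (Fin n) => (‖x - y‖ ^ ((n : ℝ) + 2 * s))⁻¹ := by
    fun_prop
  have hp : (0 : ℝ) < (n : ℝ) + 2 * s := by positivity
  have := hu.mul_bdd (c := (d ^ ((n : ℝ) + 2 * s))⁻¹) hm.aestronglyMeasurable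
    (by
      have h0 : ∀ᵐ y ∂((volume : Measure (EuclideanSpace ℝ (Fin n))).restrict Ω),
          y ∈ closure Ω := by
        have h1 : ∀ᵐ y ∂((volume : Measure (EuclideanSpace ℝ (Fin n))).restrict (closure Ω)),
            y ∈ closure Ω := ae_restrict_mem isClosed_closure.measurableSet
        exact ae_restrict_of_ae_restrict_of_subset subset_closure h1
      filter_upwards [h0] with y hy
      have hdy : d ≤ ‖x - y‖ := by
        by_contra hlt
        exact hball (by rw [Metric.mem_ball, dist_comm, dist_eq_norm]; exact not_le.1 hlt) hy
      rw [Real.norm_of_nonneg (by positivity)]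
      gcongr)
  simpa [IntegrableOn, div_eq_mul_inv] using this

/-- The double integrals in the energy of two elements of `W^{s,2}_{β,Ω}` converge absolutely. -/
theorem MemW.integrableOn_energy {n : ℕ} {s : ℝ} {Ω : Set (EuclideanSpace ℝ (Fin n))}
    {β u v : EuclideanSpace ℝ (Fin n) → ℝ} (hu : MemW s Ω β u) (hv : MemW s Ω β v) :
    IntegrableOn (fun p : EuclideanSpace ℝ (Fin n) × EuclideanSpace ℝ (Fin n) =>
      (u p.1 - u p.2) * (v p.1 - v p.2) / ‖p.1 - p.2‖ ^ ((n : ℝ) + 2 * s)) (crossSet Ω) := by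
  have hm : ∀ w : EuclideanSpace ℝ (Fin n) → ℝ, AEMeasurable w volume →
      AEMeasurable (fun p : EuclideanSpace ℝ (Fin n) × EuclideanSpace ℝ (Fin n) =>
        w p.1 - w p.2) volume := fun w hw => by
    rw [Measure.volume_eq_prod]
    exact (hw.comp_quasiMeasurePreserving Measure.quasiMeasurePreserving_fst).sub
      (hw.comp_quasiMeasurePreserving Measure.quasiMeasurePreserving_snd)
  have hk : Measurable fun p : EuclideanSpace ℝ (Fin n) × EuclideanSpace ℝ (Fin n) =>
      ‖p.1 - p.2‖ ^ ((n : ℝ) + 2 * s) := by fun_prop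
  have key : ∀ w : EuclideanSpace ℝ (Fin n) → ℝ, MemW s Ω β w →
      IntegrableOn (fun p : EuclideanSpace ℝ (Fin n) × EuclideanSpace ℝ (Fin n) =>
        |w p.1 - w p.2| ^ 2 / ‖p.1 - p.2‖ ^ ((n : ℝ) + 2 * s)) (crossSet Ω) := fun w hw => by
    refine ⟨?_, ?_⟩
    · have h1 : AEMeasurable (fun p : EuclideanSpace ℝ (Fin n) × EuclideanSpace ℝ (Fin n) =>
        |w p.1 - w p.2| ^ 2 / ‖p.1 - p.2‖ ^ ((n : ℝ) + 2 * s)) volume := by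
        simp only [sq_abs]
        exact ((hm w hw.1).pow_const 2).div hk.aemeasurable
      exact h1.aestronglyMeasurable.restrict
    · rw [hasFiniteIntegral_iff_ofReal (Eventually.of_forall fun p => by positivity)]
      exact lt_of_le_of_lt le_add_self hw.2
  refine ((key u hu).add (key v hv)).mono' ?_ (Eventually.of_forall fun p => ?_)
  · exact (((hm u hu.1).mul (hm v hv.1)).div hk.aemeasurable).aestronglyMeasurable.restrict
  · have hnn : 0 ≤ ‖p.1 - p.2‖ ^ ((n : ℝ) + 2 * s) := by positivity
    simp only [Pi.add_apply]
    rw [norm_div, Real.norm_of_nonneg hnn, ← add_div, norm_mul, Real.norm_eq_abs, Real.norm_eq_abs]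
    gcongr
    nlinarith [sq_nonneg (|u p.1 - u p.2| - |v p.1 - v p.2|), sq_nonneg |u p.1 - u p.2|,
      sq_nonneg |v p.1 - v p.2|]

/-- The exterior integral of `β u v` converges absolutely for `u`, `v` in `W^{s,2}_{β,Ω}`. -/
theorem MemW.integrableOn_exterior {n : ℕ} {s : ℝ} {Ω : Set (EuclideanSpace ℝ (Fin n))}
    {β u v : EuclideanSpace ℝ (Fin n) → ℝ} (hβ : IntegrableOn β Ωᶜ)
    (hu : MemW s Ω β u) (hv : MemW s Ω β v) :
    IntegrableOn (fun x => β x * u x * v x) Ωᶜ := by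
  have hβm : AEMeasurable β (volume.restrict Ωᶜ) := hβ.aestronglyMeasurable.aemeasurable
  have key : ∀ w : EuclideanSpace ℝ (Fin n) → ℝ, MemW s Ω β w →
      IntegrableOn (fun x => |w x| ^ 2 * |β x|) Ωᶜ := fun w hw => by
    refine ⟨?_, ?_⟩
    · have h1 := (hw.1.restrict (s := Ωᶜ)).pow_const 2
      have h2 := h1.mul hβm.norm
      simp only [sq_abs]
      exact h2.aestronglyMeasurable
    · rw [hasFiniteIntegral_iff_ofReal (Eventually.of_forall fun p => by positivity)]
      exact lt_of_le_of_lt (le_trans le_add_self le_self_add) hw.2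
  refine ((key u hu).add (key v hv)).mono' ?_ (Eventually.of_forall fun x => ?_)
  · exact ((hβm.mul hu.1.restrict).mul hv.1.restrict).aestronglyMeasurable
  · simp only [Pi.add_apply, norm_mul, Real.norm_eq_abs]
    have := mul_nonneg (abs_nonneg (β x)) (sq_nonneg (|u x| - |v x|))
    have := mul_nonneg (abs_nonneg (β x)) (sq_nonneg |u x|)
    have := mul_nonneg (abs_nonneg (β x)) (sq_nonneg |v x|)
    nlinarith

end

end NonlocalRobin

namespace NonlocalRobin

/-! For fixed `x` outside `closure Ω`, the value `u_R(x)` minimizes the quadratic function `t ↦ C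
∫_Ω |t - u(y)|² / |x - y|^(n+2s) dy + β(x) t²`, and the Robin exterior condition is its stationarity
equation (`robinExt_spec`). Everything special to the Robin problem follows from these two facts.

Minimality, integrated over the exterior, shows that the Robin extension of `v|_Ω` stays in
`W^{s,2}_{β,Ω}` when `v` is there (`MemW.robinExt`). Stationarity and Fubini show that Robin
extensions are orthogonal, for the energy, to the elements of the space that vanish in `Ω`
(`robinEnergy_robinExt_eq_zero`). So a test function `v` may be replaced by the Robin extension of
`v|_Ω`, and the weak formulation becomes the form identity
(`exists_robinForm_eq_iff_isWeakRobinSolution`).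

The form is densely defined because smooth compactly supported functions lie in the space. It is
closed because the energy is lower semicontinuous in `L²(Ω)` (`robinEnergy_le_of_tendsto`): an `L²`
limit gives a.e. convergence of a subsequence of the extensions, and Fatou's lemma applies.
Selfadjointness is then abstract: Riesz representation for `a + (·,·)` makes `A + 1` onto, and a
symmetric non-negative operator with this property is selfadjoint.

The Lipschitz condition enters only through the nullity of `frontier Ω`. -/

/-- The Riesz representation theorem for a sequentially complete inner product that is given as a
bilinear form on a real vector space. -/
theorem exists_forall_eq_of_complete {V : Type*} [AddCommGroup V] [Module ℝ V]
    (B : LinearMap.BilinForm ℝ V) (hsymm : ∀ u v, B u v = B v u) (hnn : ∀ u, 0 ≤ B u u)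
    (hdef : ∀ u, B u u = 0 → u = 0)
    (hcomplete : ∀ u : ℕ → V,
      Tendsto (fun p : ℕ × ℕ => B (u p.1 - u p.2) (u p.1 - u p.2)) atTop (𝓝 0) →
      ∃ w, Tendsto (fun k => B (u k - w) (u k - w)) atTop (𝓝 0))
    (l : V →ₗ[ℝ] ℝ) (C : ℝ) (hl : ∀ v, |l v| ≤ C * √(B v v)) :
    ∃ u, ∀ v, B u v = l v := by
  -- `V` is assumed to have no norm of its own, so the result also applies to a form domain, whose
  -- ambient norm is not the one given by `B`.
  let core : InnerProductSpace.Core ℝ V :=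
    { inner := fun u v => B u v
      conj_inner_symm := fun u v => by simpa using hsymm v u
      re_inner_nonneg := fun u => by simpa using hnn u
      add_left := fun u v w => by simp
      smul_left := fun u v r => by simp
      definite := hdef }
  let _ : NormedAddCommGroup V := core.toNormedAddCommGroup
  let _ : InnerProductSpace ℝ V := InnerProductSpace.ofCore core.toCore
  have hnorm : ∀ v : V, ‖v‖ = √(B v v) := fun v => rfl
  have hsq : ∀ v : V, ‖v‖ ^ 2 = B v v := fun v => by rw [hnorm, Real.sq_sqrt (hnn v)]
  have : CompleteSpace V := by
    refine Metric.complete_of_cauchySeq_tendsto fun u hu => ?_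
    have h1 : Tendsto (fun p : ℕ × ℕ => ‖u p.1 - u p.2‖ ^ 2) atTop (𝓝 0) := by
      have := cauchySeq_iff_tendsto_dist_atTop_0.1 hu
      simpa [dist_eq_norm] using this.pow 2
    obtain ⟨w, hw⟩ := hcomplete u (by simpa only [hsq] using h1)
    refine ⟨w, tendsto_iff_norm_sub_tendsto_zero.2 ?_⟩
    have := hw.sqrt
    simpa only [← hnorm, Real.sqrt_zero] using this
  let L : StrongDual ℝ V := l.mkContinuous C fun v => by rw [hnorm]; exact hl v
  exact ⟨(InnerProductSpace.toDual ℝ V).symm L, fun v =>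
    InnerProductSpace.toDual_symm_apply (𝕜 := ℝ) (x := v) (y := L)⟩

/-! ### Operators associated with closed forms -/

section Form

variable {H : Type*} [NormedAddCommGroup H] [InnerProductSpace ℝ H]
  {D : Submodule ℝ H} {a : LinearMap.BilinForm ℝ D}

/-- The graph of the operator associated with a bilinear form. -/
def formGraph (D : Submodule ℝ H) (a : LinearMap.BilinForm ℝ D) : Submodule ℝ (H × H) where
  carrier := {p | ∃ hu : p.1 ∈ D, ∀ v : D, a ⟨p.1, hu⟩ v = inner ℝ p.2 (v : H)}
  add_mem' := by
    rintro ⟨u, f⟩ ⟨u', f'⟩ ⟨hu, h⟩ ⟨hu', h'⟩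
    refine ⟨D.add_mem hu hu', fun v => ?_⟩
    have : (⟨u + u', D.add_mem hu hu'⟩ : D) = ⟨u, hu⟩ + ⟨u', hu'⟩ := rfl
    simp only [Prod.mk_add_mk, this, map_add, LinearMap.add_apply, inner_add_left]
    rw [h, h']
  zero_mem' := ⟨D.zero_mem, fun v => by
    have : (⟨(0 : H × H).1, D.zero_mem⟩ : D) = 0 := rfl
    rw [this]
    simp⟩
  smul_mem' := by
    rintro c ⟨u, f⟩ ⟨hu, h⟩
    refine ⟨D.smul_mem c hu, fun v => ?_⟩
    have : (⟨c • u, D.smul_mem c hu⟩ : D) = c • ⟨u, hu⟩ := rfl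
    simp only [Prod.smul_mk, this, map_smul, LinearMap.smul_apply, inner_smul_left]
    rw [h]
    simp

/-- The operator associated with a bilinear form. -/
noncomputable def formOperator (D : Submodule ℝ H) (a : LinearMap.BilinForm ℝ D) : H →ₗ.[ℝ] H :=
  (formGraph D a).toLinearPMap

/-- Density makes the relation single-valued: a pair `(0, f)` in it has `f` orthogonal to `D`, hence
`f = 0`. -/
theorem formOperator_graph (hD : Dense (D : Set H)) :
    (formOperator D a).graph = formGraph D a := by
  refine Submodule.toLinearPMap_graph_eq _ fun p hp hp1 => ?_
  obtain ⟨hu, h⟩ := hp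
  refine hD.eq_zero_of_inner_left ℝ fun v hv => ?_
  have : (⟨p.1, hu⟩ : D) = 0 := by simpa [Subtype.ext_iff] using hp1
  rw [← h ⟨v, hv⟩, this]
  simp

theorem isAssociatedOperator_formOperator (hD : Dense (D : Set H)) :
    IsAssociatedOperator D a (formOperator D a) := fun u f => by
  rw [formOperator_graph hD]
  rfl

/-- For a closed non-negative symmetric form, `A + 1` is onto. -/
theorem IsClosedForm.exists_form_add_inner_eq (hsymm : ∀ u v, a u v = a v u)
    (hnn : ∀ u, 0 ≤ a u u) (hclosed : IsClosedForm D a) (f : H) :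
    ∃ u : D, ∀ v : D, a u v + inner ℝ (u : H) (v : H) = inner ℝ f (v : H) := by
  let B : LinearMap.BilinForm ℝ D := a + (innerₗ H).domRestrict₁₂ D D
  have hB : ∀ u v, B u v = a u v + inner ℝ (u : H) (v : H) := fun u v => rfl
  obtain ⟨u, hu⟩ := exists_forall_eq_of_complete B
    (fun u v => by rw [hB, hB, hsymm, real_inner_comm])
    (fun u => by rw [hB]; exact add_nonneg (hnn u) real_inner_self_nonneg)
    (fun u h => by
      rw [hB] at h
      have h1 := hnn u
      have h2 : 0 ≤ inner ℝ (u : H) (u : H) := real_inner_self_nonneg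
      have h3 : inner ℝ (u : H) (u : H) = 0 := by linarith
      exact Subtype.ext (inner_self_eq_zero.1 h3))
    (fun u h => by
      obtain ⟨w, hw⟩ := hclosed 1 one_pos u (by simpa only [hB, one_mul, Submodule.coe_inner] using h)
      exact ⟨w, by simpa only [hB, one_mul, Submodule.coe_inner] using hw⟩)
    ((innerₗ H f).comp D.subtype) ‖f‖ (fun v => by
      have h1 : ‖(v : H)‖ ≤ √(B v v) := by
        refine Real.le_sqrt_of_sq_le ?_
        rw [hB, real_inner_self_eq_norm_sq]
        linarith [hnn v]
      calc |inner ℝ f (v : H)| ≤ ‖f‖ * ‖(v : H)‖ := abs_real_inner_le_norm _ _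
        _ ≤ _ := by gcongr)
  exact ⟨u, fun v => by rw [← hB, hu]; rfl⟩

/-- The operator associated with a closed, symmetric, non-negative and densely defined form is
selfadjoint. -/
theorem isSelfAdjoint_formOperator [CompleteSpace H] (hsymm : ∀ u v, a u v = a v u)
    (hnn : ∀ u, 0 ≤ a u u) (hD : Dense (D : Set H)) (hclosed : IsClosedForm D a) :
    IsSelfAdjoint (formOperator D a) := by
  set A := formOperator D a with hA
  have hgraph : ∀ u f : H, (u, f) ∈ A.graph ↔
      ∃ hu : u ∈ D, ∀ v : D, a ⟨u, hu⟩ v = inner ℝ f (v : H) :=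
    isAssociatedOperator_formOperator hD
  have happ : ∀ x : A.domain, ∃ hu : (x : H) ∈ D, ∀ v : D, a ⟨x, hu⟩ v = inner ℝ (A x) (v : H) :=
    fun x => (hgraph _ _).1 (A.mem_graph x)
  have hres : ∀ f : H, ∃ x : A.domain, A x + (x : H) = f := fun f => by
    obtain ⟨u, hu⟩ := hclosed.exists_form_add_inner_eq hsymm hnn f
    have h : ((u : H), f - u) ∈ A.graph :=
      (hgraph _ _).2 ⟨u.2, fun v => by rw [inner_sub_left, ← hu v]; simp⟩
    obtain ⟨x, hx1, hx2⟩ := A.mem_graph_iff.1 h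
    exact ⟨x, by rw [hx2, hx1]; simp⟩
  have hform : ∀ x y : A.domain, inner ℝ (A x) (y : H) = inner ℝ (x : H) (A y) := fun x y => by
    obtain ⟨hx, hx'⟩ := happ x
    obtain ⟨hy, hy'⟩ := happ y
    rw [← hx' ⟨y, hy⟩, hsymm, hy' ⟨x, hx⟩, real_inner_comm]
  -- If `f = A x + x` is orthogonal to the domain, pairing with `x` gives `(A x, x) + ‖x‖² = 0`, so
  -- `x = 0` and `f = 0`.
  have hdense : Dense (A.domain : Set H) := by
    rw [Submodule.dense_iff_topologicalClosure_eq_top, Submodule.topologicalClosure_eq_top_iff,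
      Submodule.eq_bot_iff]
    intro f hf
    obtain ⟨x, hx⟩ := hres f
    obtain ⟨hxD, hx'⟩ := happ x
    have h1 : inner ℝ (x : H) f = 0 := (Submodule.mem_orthogonal _ _).1 hf x x.2
    have h2 : 0 ≤ inner ℝ (A x) (x : H) := by rw [← hx' ⟨x, hxD⟩]; exact hnn _
    rw [← hx, inner_add_right, real_inner_comm] at h1
    have h3 : (0 : ℝ) ≤ inner ℝ (x : H) (x : H) := real_inner_self_nonneg
    have h4 : (x : H) = 0 := inner_self_eq_zero.1 (by linarith : inner ℝ (x : H) (x : H) = 0)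
    have h5 : x = 0 := Subtype.ext h4
    rw [← hx, h5]
    simp
  have hle := LinearPMap.IsFormalAdjoint.le_adjoint hdense hform
  rw [LinearPMap.isSelfAdjoint_def]
  refine (LinearPMap.eq_of_le_of_domain_eq hle (le_antisymm hle.1 fun x hx => ?_)).symm
  -- Choose `y` in the domain of `A` with `(A + 1) y = (A* + 1) x`. Then `x - y` is orthogonal to
  -- the range of `A + 1`, which is all of `H`.
  obtain ⟨y, hy⟩ := hres (A.adjoint ⟨x, hx⟩ + x)
  have hxy : x = y := by
    refine ext_inner_right ℝ fun g => ?_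
    obtain ⟨z, rfl⟩ := hres g
    have h1 := LinearPMap.adjoint_isFormalAdjoint hdense ⟨x, hx⟩ z
    have h2 := congrArg (fun t => inner ℝ t (z : H)) hy
    simp only [inner_add_left] at h2
    rw [inner_add_right, inner_add_right, ← hform, h2, ← h1]
  rw [hxy]
  exact y.2

end Form

/-! ### Null boundary, and the kernel away from the closure of `Ω` -/

section Kernel

variable {n : ℕ} {s : ℝ} {Ω : Set (EuclideanSpace ℝ (Fin n))}

theorem fracConst_pos (hs0 : 0 < s) (hs1 : s < 1) : 0 < fracConst n s := by
  have h1 : 0 < Real.Gamma ((2 * s + n) / 2) := Real.Gamma_pos_of_pos (by positivity)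
  have h2 : 0 < Real.Gamma (1 - s) := Real.Gamma_pos_of_pos (by linarith)
  have := Real.pi_pos
  unfold fracConst
  positivity

/-- A Lipschitz graph, in the direction of a unit vector, is a null set. -/
theorem volume_lipschitzGraph_eq_zero {e : EuclideanSpace ℝ (Fin n)} (he : ‖e‖ = 1)
    {γ : EuclideanSpace ℝ (Fin n) → ℝ} (hγ : Continuous γ) :
    volume {x | inner ℝ e x - γ (x - inner ℝ e x • e) = 0} = 0 := by
  set g : EuclideanSpace ℝ (Fin n) → ℝ := fun x => inner ℝ e x - γ (x - inner ℝ e x • e) with hg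
  have hgm : Measurable g := by
    have : Continuous g := by fun_prop
    exact this.measurable
  -- Subtracting `t • e` lowers `g` by `t` and leaves the component orthogonal to `e` unchanged, so
  -- all level sets are translates of one another.
  have hlevel : ∀ t : ℝ, volume {x | g x = t} = volume {x | g x = 0} := fun t => by
    have : {x | g x = t} = (fun x => x + -(t • e)) ⁻¹' {x | g x = 0} := by
      ext x
      have h1 : inner ℝ e (x + -(t • e)) = inner ℝ e x - t := by
        rw [inner_add_right, inner_neg_right, inner_smul_right, real_inner_self_eq_norm_sq, he]
        ring
      have h2 : x + -(t • e) - (inner ℝ e x - t) • e = x - inner ℝ e x • e := by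
        rw [sub_smul]; abel
      simp only [Set.mem_ofPred_eq, Set.mem_preimage, hg, h1, h2]
      constructor <;> intro h <;> linarith
    rw [this, measure_preimage_add_right]
  -- Only countably many level sets can have positive measure, whereas one positive level set would
  -- make them all positive.
  have hc := Measure.countable_meas_level_set_pos (μ := (volume : Measure
    (EuclideanSpace ℝ (Fin n)))) hgm
  by_contra hne
  have : {t : ℝ | 0 < volume {x | g x = t}} = Set.univ := by
    refine Set.eq_univ_of_forall fun t => ?_
    rw [Set.mem_ofPred_eq, hlevel]
    exact pos_iff_ne_zero.2 hne
  rw [this] at hc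
  exact Cardinal.not_countable_real hc

/-- Locally the frontier lies in the graph: strictly above or below it, continuity puts a whole
neighbourhood inside or outside `Ω`. -/
theorem HasLipschitzBoundary.volume_frontier_eq_zero (h : HasLipschitzBoundary Ω) :
    volume (frontier Ω) = 0 := by
  refine measure_null_of_locally_null _ fun z hz => ?_
  obtain ⟨r, e, K, γ, hr, he, hγ, hball⟩ := h z hz
  have hc := hγ.continuous
  refine ⟨frontier Ω ∩ Metric.ball z r, inter_mem_nhdsWithin _ (Metric.ball_mem_nhds z hr),
    measure_mono_null ?_ (volume_lipschitzGraph_eq_zero he hc)⟩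
  rintro x ⟨hx, hxb⟩
  have hev : ∀ᶠ y in 𝓝 x, y ∈ Metric.ball z r := Metric.isOpen_ball.mem_nhds hxb
  have hg : Continuous fun y : EuclideanSpace ℝ (Fin n) =>
      inner ℝ e y - γ (y - inner ℝ e y • e) := by fun_prop
  rw [Set.mem_ofPred_eq]
  by_contra hne
  rcases lt_or_gt_of_ne hne with hlt | hgt
  · have : ∀ᶠ y in 𝓝 x, y ∉ Ω := by
      filter_upwards [hev, hg.continuousAt.eventually_lt_const hlt] with y hy hy'
      rw [hball y hy]
      linarith
    exact (mem_closure_iff_frequently.1 (frontier_subset_closure hx)) this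
  · have : ∀ᶠ y in 𝓝 x, y ∈ Ω := by
      filter_upwards [hev, hg.continuousAt.eventually_const_lt hgt] with y hy hy'
      rw [hball y hy]
      linarith
    exact hx.2 (mem_interior_iff_mem_nhds.2 this)

theorem ae_notMem_closure (hfr : volume (frontier Ω) = 0) :
    ∀ᵐ x ∂(volume : Measure (EuclideanSpace ℝ (Fin n))), x ∉ Ω → x ∉ closure Ω := by
  filter_upwards [measure_eq_zero_iff_ae_notMem.1 hfr] with x hx hxΩ hxc
  exact hx ⟨hxc, fun h => hxΩ (interior_subset h)⟩

theorem exists_pos_le_norm_sub {x : EuclideanSpace ℝ (Fin n)} (hx : x ∉ closure Ω) :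
    ∃ d > 0, ∀ y ∈ Ω, d ≤ ‖x - y‖ := by
  obtain ⟨d, hd, hball⟩ := Metric.isOpen_iff.1 isClosed_closure.isOpen_compl x hx
  refine ⟨d, hd, fun y hy => ?_⟩
  by_contra hlt
  exact hball (by rw [Metric.mem_ball, dist_comm, dist_eq_norm]; exact not_le.1 hlt)
    (subset_closure hy)

/-- A point off `closure Ω` has positive distance to `Ω`, so the singularity is never met. This
bound makes the integrals over `Ω` at a fixed exterior point converge. -/
theorem exists_kernel_le (hs : 0 < s) {x : EuclideanSpace ℝ (Fin n)} (hx : x ∉ closure Ω) :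
    ∃ M : ℝ, ∀ y ∈ Ω, ‖(‖x - y‖ ^ ((n : ℝ) + 2 * s))⁻¹‖ ≤ M := by
  obtain ⟨d, hd, h⟩ := exists_pos_le_norm_sub hx
  refine ⟨(d ^ ((n : ℝ) + 2 * s))⁻¹, fun y hy => ?_⟩
  have := h y hy
  have hp : (0 : ℝ) ≤ (n : ℝ) + 2 * s := by positivity
  rw [Real.norm_of_nonneg (by positivity)]
  gcongr

theorem IntegrableOn.div_kernel (hs : 0 < s) (hΩ : MeasurableSet Ω)
    {g : EuclideanSpace ℝ (Fin n) → ℝ} (hg : IntegrableOn g Ω)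
    {x : EuclideanSpace ℝ (Fin n)} (hx : x ∉ closure Ω) :
    IntegrableOn (fun y => g y / ‖x - y‖ ^ ((n : ℝ) + 2 * s)) Ω := by
  obtain ⟨M, hM⟩ := exists_kernel_le hs hx
  have hm : Measurable fun y : EuclideanSpace ℝ (Fin n) => (‖x - y‖ ^ ((n : ℝ) + 2 * s))⁻¹ := by
    fun_prop
  simpa only [IntegrableOn, div_eq_mul_inv] using
    Integrable.mul_bdd (c := M) hg hm.aestronglyMeasurable
      ((ae_restrict_iff' hΩ).2 (Eventually.of_forall hM))

/-- This makes the potential at `x` a continuous functional on `L²(Ω)`; see `tendsto_potential`. -/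
theorem memLp_kernel (hs : 0 < s) (hΩ : MeasurableSet Ω) (hb : volume Ω ≠ ⊤)
    {x : EuclideanSpace ℝ (Fin n)} (hx : x ∉ closure Ω) :
    MemLp (fun y => (‖x - y‖ ^ ((n : ℝ) + 2 * s))⁻¹) 2 (volume.restrict Ω) := by
  have : IsFiniteMeasure ((volume : Measure (EuclideanSpace ℝ (Fin n))).restrict Ω) :=
    ⟨by simpa using hb.lt_top⟩
  obtain ⟨M, hM⟩ := exists_kernel_le hs hx
  have hm : Measurable fun y : EuclideanSpace ℝ (Fin n) => (‖x - y‖ ^ ((n : ℝ) + 2 * s))⁻¹ := by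
    fun_prop
  exact MemLp.of_bound hm.aestronglyMeasurable M
    ((ae_restrict_iff' hΩ).2 (Eventually.of_forall hM))

/-- The Riesz-type potential `∫_Ω u(y) |x - y|^{-n-2s} dy`. -/
noncomputable def potential (s : ℝ) (Ω : Set (EuclideanSpace ℝ (Fin n)))
    (u : EuclideanSpace ℝ (Fin n) → ℝ) (x : EuclideanSpace ℝ (Fin n)) : ℝ :=
  ∫ y in Ω, u y / ‖x - y‖ ^ ((n : ℝ) + 2 * s)

theorem potential_congr_ae {u v : EuclideanSpace ℝ (Fin n) → ℝ}
    (h : u =ᵐ[volume.restrict Ω] v) : potential s Ω u = potential s Ω v := by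
  ext x
  refine integral_congr_ae ?_
  filter_upwards [h] with y hy
  rw [hy]

theorem measurable_potential {u : EuclideanSpace ℝ (Fin n) → ℝ}
    (hu : AEMeasurable u (volume.restrict Ω)) : Measurable (potential s Ω u) := by
  rw [potential_congr_ae hu.ae_eq_mk]
  have := hu.measurable_mk
  refine StronglyMeasurable.measurable (StronglyMeasurable.integral_prod_right'
    (f := fun p : EuclideanSpace ℝ (Fin n) × EuclideanSpace ℝ (Fin n) =>
      hu.mk u p.2 / ‖p.1 - p.2‖ ^ ((n : ℝ) + 2 * s)) (Measurable.stronglyMeasurable ?_))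
  fun_prop

theorem rho_nonneg (x : EuclideanSpace ℝ (Fin n)) : 0 ≤ rho s Ω x :=
  integral_nonneg fun _ => by positivity

/-- The weight `ρ` vanishes only if `Ω` is a null set. -/
theorem potential_eq_zero_of_rho_eq_zero (hs : 0 < s) (hΩ : MeasurableSet Ω)
    (hb : volume Ω ≠ ⊤) (u : EuclideanSpace ℝ (Fin n) → ℝ) {x : EuclideanSpace ℝ (Fin n)}
    (hx : x ∉ closure Ω) (h : rho s Ω x = 0) : potential s Ω u x = 0 := by
  have h1 : IntegrableOn (fun y => 1 / ‖x - y‖ ^ ((n : ℝ) + 2 * s)) Ω :=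
    IntegrableOn.div_kernel hs hΩ (integrableOn_const hb) hx
  have h2 := (integral_eq_zero_iff_of_nonneg (fun _ => by positivity) h1).1 h
  refine integral_eq_zero_of_ae ?_
  filter_upwards [h2] with y hy
  have : (‖x - y‖ ^ ((n : ℝ) + 2 * s))⁻¹ = 0 := by simpa using hy
  rw [div_eq_mul_inv, this]
  simp

end Kernel

/-! ### The Robin extension at a single exterior point -/

section Extension

variable {n : ℕ} {s : ℝ} {Ω : Set (EuclideanSpace ℝ (Fin n))}
  {β u v : EuclideanSpace ℝ (Fin n) → ℝ} {x : EuclideanSpace ℝ (Fin n)}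

theorem robinExt_of_mem (hx : x ∈ Ω) : robinExt s Ω β u x = u x := if_pos hx

theorem robinExt_of_notMem (hx : x ∉ Ω) : robinExt s Ω β u x =
    fracConst n s / (fracConst n s * rho s Ω x + β x) * potential s Ω u x := if_neg hx

theorem robinExt_ae_eq (hΩ : MeasurableSet Ω) :
    robinExt s Ω β u =ᵐ[volume.restrict Ω] u :=
  (ae_restrict_iff' hΩ).2 (Eventually.of_forall fun _ => robinExt_of_mem)

theorem robinExt_congr_ae (hΩ : MeasurableSet Ω) (h : u =ᵐ[volume.restrict Ω] v) :
    robinExt s Ω β u =ᵐ[volume] robinExt s Ω β v := by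
  filter_upwards [(ae_restrict_iff' hΩ).1 h] with x hx
  by_cases hxΩ : x ∈ Ω
  · rw [robinExt_of_mem hxΩ, robinExt_of_mem hxΩ, hx hxΩ]
  · rw [robinExt_of_notMem hxΩ, robinExt_of_notMem hxΩ, potential_congr_ae h]

theorem aemeasurable_robinExt (hΩ : MeasurableSet Ω) (hβ : AEMeasurable β (volume.restrict Ωᶜ))
    (hu : AEMeasurable u (volume.restrict Ω)) : AEMeasurable (robinExt s Ω β u) volume := by
  have h : AEMeasurable (robinExt s Ω β u) (volume.restrict (Ω ∪ Ωᶜ)) := by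
    refine aemeasurable_union_iff.2 ⟨hu.congr (robinExt_ae_eq hΩ).symm, ?_⟩
    -- By definition `rho` is the potential of the constant function 1.
    have hρ : Measurable (rho s Ω) := measurable_potential aemeasurable_const
    have hp : Measurable (potential s Ω u) := measurable_potential hu
    have : AEMeasurable (fun x => fracConst n s / (fracConst n s * rho s Ω x + β x) *
        potential s Ω u x) (volume.restrict Ωᶜ) :=
      (aemeasurable_const.div ((hρ.const_mul _).aemeasurable.add hβ)).mul hp.aemeasurable
    exact this.congr ((ae_restrict_iff' hΩ.compl).2
      (Eventually.of_forall fun x hx => (robinExt_of_notMem hx).symm))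
  simpa using h

/-- The equation that defines the Robin extension. -/
theorem robinExt_spec (hs0 : 0 < s) (hs1 : s < 1) (hΩ : MeasurableSet Ω) (hb : volume Ω ≠ ⊤)
    (hx : x ∉ closure Ω) (hβx : 0 ≤ β x) :
    (fracConst n s * rho s Ω x + β x) * robinExt s Ω β u x =
      fracConst n s * potential s Ω u x := by
  have hC := fracConst_pos (n := n) hs0 hs1
  have hρ := rho_nonneg (s := s) (Ω := Ω) x
  rw [robinExt_of_notMem (fun h => hx (subset_closure h))]
  -- If `ρ(x) = 0`, the denominator may vanish and the quotient take its default value 0; the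
  -- potential vanishes too, so both sides are 0.
  rcases hρ.eq_or_lt with h0 | hpos
  · rw [potential_eq_zero_of_rho_eq_zero hs0 hΩ hb u hx h0.symm]
    simp
  · have : fracConst n s * rho s Ω x + β x ≠ 0 := by positivity
    field_simp

/-- The nonlocal Robin exterior condition, pointwise. -/
theorem nonlocalNormalDeriv_robinExt_add (hs0 : 0 < s) (hs1 : s < 1) (hΩ : MeasurableSet Ω)
    (hb : volume Ω ≠ ⊤) (hu : IntegrableOn u Ω) (hx : x ∉ closure Ω) (hβx : 0 ≤ β x) :
    nonlocalNormalDeriv s Ω (robinExt s Ω β u) x + β x * robinExt s Ω β u x = 0 := by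
  have hspec := robinExt_spec (u := u) hs0 hs1 hΩ hb hx hβx
  have h1 : ∫ y in Ω, (robinExt s Ω β u x - robinExt s Ω β u y) / ‖x - y‖ ^ ((n : ℝ) + 2 * s) =
      robinExt s Ω β u x * rho s Ω x - potential s Ω u x := by
    rw [rho, potential, ← integral_const_mul, ← integral_sub]
    · refine setIntegral_congr_fun hΩ fun y hy => ?_
      simp only [robinExt_of_mem hy]
      ring
    · exact (IntegrableOn.div_kernel hs0 hΩ (integrableOn_const hb) hx).const_mul _
    · exact IntegrableOn.div_kernel hs0 hΩ hu hx
  rw [nonlocalNormalDeriv, h1]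
  linarith

theorem integrableOn_sq_sub_div_kernel (hs0 : 0 < s) (hΩ : MeasurableSet Ω) (hb : volume Ω ≠ ⊤)
    (hu : MemLp u 2 (volume.restrict Ω)) (hx : x ∉ closure Ω) (t : ℝ) :
    IntegrableOn (fun y => |t - u y| ^ 2 / ‖x - y‖ ^ ((n : ℝ) + 2 * s)) Ω := by
  have : IsFiniteMeasure ((volume : Measure (EuclideanSpace ℝ (Fin n))).restrict Ω) :=
    ⟨by simpa using hb.lt_top⟩
  refine IntegrableOn.div_kernel hs0 hΩ ?_ hx
  simp only [sq_abs]
  exact ((memLp_const t).sub hu).integrable_sq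

/-- The Robin extension minimizes the exterior energy density. -/
theorem robinExt_minimizes (hs0 : 0 < s) (hs1 : s < 1) (hΩ : MeasurableSet Ω)
    (hb : volume Ω ≠ ⊤) (hu : MemLp u 2 (volume.restrict Ω)) (hx : x ∉ closure Ω)
    (hβx : 0 ≤ β x) (t : ℝ) :
    fracConst n s * (∫ y in Ω, |robinExt s Ω β u x - u y| ^ 2 / ‖x - y‖ ^ ((n : ℝ) + 2 * s)) +
        |robinExt s Ω β u x| ^ 2 * |β x| ≤
      fracConst n s * (∫ y in Ω, |t - u y| ^ 2 / ‖x - y‖ ^ ((n : ℝ) + 2 * s)) +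
        |t| ^ 2 * |β x| := by
  have : IsFiniteMeasure ((volume : Measure (EuclideanSpace ℝ (Fin n))).restrict Ω) :=
    ⟨by simpa using hb.lt_top⟩
  have hC := fracConst_pos (n := n) hs0 hs1
  have hρ := rho_nonneg (s := s) (Ω := Ω) x
  have hspec := robinExt_spec (u := u) hs0 hs1 hΩ hb hx hβx
  have hexp : ∀ r : ℝ, ∫ y in Ω, |r - u y| ^ 2 / ‖x - y‖ ^ ((n : ℝ) + 2 * s) =
      r ^ 2 * rho s Ω x - 2 * r * potential s Ω u x + potential s Ω (fun y => u y ^ 2) x := by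
    intro r
    have i1 : IntegrableOn (fun y => 1 / ‖x - y‖ ^ ((n : ℝ) + 2 * s)) Ω :=
      IntegrableOn.div_kernel hs0 hΩ (integrableOn_const hb) hx
    have i2 : IntegrableOn (fun y => u y / ‖x - y‖ ^ ((n : ℝ) + 2 * s)) Ω :=
      IntegrableOn.div_kernel hs0 hΩ (hu.integrable (by norm_num)) hx
    have i3 : IntegrableOn (fun y => u y ^ 2 / ‖x - y‖ ^ ((n : ℝ) + 2 * s)) Ω :=
      IntegrableOn.div_kernel hs0 hΩ hu.integrable_sq hx
    have i4 : IntegrableOn (fun y => r ^ 2 * (1 / ‖x - y‖ ^ ((n : ℝ) + 2 * s)) -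
        2 * r * (u y / ‖x - y‖ ^ ((n : ℝ) + 2 * s))) Ω := (i1.const_mul _).sub (i2.const_mul _)
    rw [rho, potential, potential, ← integral_const_mul, ← integral_const_mul,
      ← integral_sub (i1.const_mul _) (i2.const_mul _), ← integral_add i4 i3]
    refine integral_congr_ae (Eventually.of_forall fun y => ?_)
    simp only [sq_abs]
    ring
  rw [hexp, hexp, abs_of_nonneg hβx, sq_abs, sq_abs]
  generalize robinExt s Ω β u x = r at hspec ⊢
  -- By `hspec` the linear terms complete the square: the two sides differ by exactly this quantity.
  have : 0 ≤ (fracConst n s * rho s Ω x + β x) * (t - r) ^ 2 := by positivity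
  linear_combination this - 2 * (t - r) * hspec

end Extension

/-! ### The space `W^{s,2}_{β,Ω}` and its energy -/

section Sobolev

variable {n : ℕ} {s : ℝ} {Ω : Set (EuclideanSpace ℝ (Fin n))}
  {β u v w : EuclideanSpace ℝ (Fin n) → ℝ}

theorem crossSet_eq_union (Ω : Set (EuclideanSpace ℝ (Fin n))) :
    crossSet Ω = Ω ×ˢ Ω ∪ Ω ×ˢ Ωᶜ ∪ Ωᶜ ×ˢ Ω := by
  ext ⟨x, y⟩
  simp only [crossSet, Set.mem_compl_iff, Set.mem_prod, Set.mem_union]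
  tauto

/-- The swap exchanges the two mixed pieces, whence the factor 2. It accounts for the constants
`C/2` and `C` in `energy`, which combine to `C/2` over `crossSet Ω`. -/
theorem setIntegral_crossSet (hΩ : MeasurableSet Ω)
    {g : EuclideanSpace ℝ (Fin n) × EuclideanSpace ℝ (Fin n) → ℝ}
    (hg : IntegrableOn g (crossSet Ω)) (hsymm : ∀ p, g p.swap = g p) :
    ∫ p in crossSet Ω, g p =
      (∫ x in Ω, ∫ y in Ω, g (x, y)) + 2 * ∫ x in Ω, ∫ y in Ωᶜ, g (x, y) := by
  have h := crossSet_eq_union Ω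
  rw [h] at hg ⊢
  have h12 := hg.left_of_union
  rw [setIntegral_union _ (hΩ.compl.prod hΩ) h12 hg.right_of_union,
    setIntegral_union _ (hΩ.prod hΩ.compl) h12.left_of_union h12.right_of_union]
  · have hswap : ∫ p in Ωᶜ ×ˢ Ω, g p = ∫ p in Ω ×ˢ Ωᶜ, g p := by
      rw [Measure.volume_eq_prod, ← setIntegral_prod_swap]
      simp only [hsymm]
    rw [hswap, Measure.volume_eq_prod, setIntegral_prod _ h12.left_of_union,
      setIntegral_prod _ h12.right_of_union]
    ring
  · rw [Set.disjoint_left]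
    rintro ⟨x, y⟩ ⟨_, h2⟩ ⟨_, h4⟩
    exact h4 h2
  · rw [Set.disjoint_left]
    rintro ⟨x, y⟩ (⟨h1, _⟩ | ⟨h1, _⟩) ⟨h3, _⟩ <;> exact h3 h1

/-- Finiteness only needs an upper bound, and subadditivity over unions asks for no measurability.
-/
theorem setLIntegral_crossSet_le (Ω : Set (EuclideanSpace ℝ (Fin n)))
    (g : EuclideanSpace ℝ (Fin n) × EuclideanSpace ℝ (Fin n) → ENNReal)
    (hsymm : ∀ p, g p.swap = g p) :
    ∫⁻ p in crossSet Ω, g p ≤ (∫⁻ p in Ω ×ˢ Ω, g p) + 2 * ∫⁻ p in Ωᶜ ×ˢ Ω, g p := by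
  rw [crossSet_eq_union]
  have hswap : ∫⁻ p in Ω ×ˢ Ωᶜ, g p = ∫⁻ p in Ωᶜ ×ˢ Ω, g p := by
    rw [Measure.volume_eq_prod, ← Measure.prod_restrict, ← Measure.prod_restrict,
      ← lintegral_prod_swap]
    simp only [hsymm]
  calc _ ≤ _ := lintegral_union_le _ _ _
    _ ≤ (∫⁻ p in Ω ×ˢ Ω, g p) + (∫⁻ p in Ω ×ˢ Ωᶜ, g p) + ∫⁻ p in Ωᶜ ×ˢ Ω, g p := by
      gcongr
      exact lintegral_union_le _ _ _
    _ = _ := by rw [hswap]; ring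

theorem aemeasurable_sub_prod (hu : AEMeasurable u volume) :
    AEMeasurable (fun p : EuclideanSpace ℝ (Fin n) × EuclideanSpace ℝ (Fin n) =>
      u p.1 - u p.2) volume := by
  rw [Measure.volume_eq_prod]
  exact (hu.comp_quasiMeasurePreserving Measure.quasiMeasurePreserving_fst).sub
    (hu.comp_quasiMeasurePreserving Measure.quasiMeasurePreserving_snd)

theorem aemeasurable_quotient (s : ℝ) (hu : AEMeasurable u volume) :
    AEMeasurable (fun p : EuclideanSpace ℝ (Fin n) × EuclideanSpace ℝ (Fin n) =>
      |u p.1 - u p.2| ^ 2 / ‖p.1 - p.2‖ ^ ((n : ℝ) + 2 * s)) volume := by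
  have hk : Measurable fun p : EuclideanSpace ℝ (Fin n) × EuclideanSpace ℝ (Fin n) =>
      ‖p.1 - p.2‖ ^ ((n : ℝ) + 2 * s) := by fun_prop
  simp only [sq_abs]
  exact ((aemeasurable_sub_prod hu).pow_const 2).div hk.aemeasurable

theorem lintegral_ofReal_lt_top_iff {α : Type*} [MeasurableSpace α] {μ : Measure α} {g : α → ℝ}
    (hg : AEMeasurable g μ) (h0 : ∀ x, 0 ≤ g x) :
    ∫⁻ x, ENNReal.ofReal (g x) ∂μ < ⊤ ↔ Integrable g μ := by
  rw [← hasFiniteIntegral_iff_ofReal (Eventually.of_forall h0)]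
  exact ⟨fun h => ⟨hg.aestronglyMeasurable, h⟩, fun h => h.2⟩

theorem memW_iff (hβ : AEMeasurable β (volume.restrict Ωᶜ)) :
    MemW s Ω β u ↔ AEMeasurable u volume ∧
      IntegrableOn (fun x => |u x| ^ 2) Ω ∧ IntegrableOn (fun x => |u x| ^ 2 * |β x|) Ωᶜ ∧
      IntegrableOn (fun p : EuclideanSpace ℝ (Fin n) × EuclideanSpace ℝ (Fin n) =>
        |u p.1 - u p.2| ^ 2 / ‖p.1 - p.2‖ ^ ((n : ℝ) + 2 * s)) (crossSet Ω) := by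
  refine and_congr_right fun hu => ?_
  have h1 : AEMeasurable (fun x => |u x| ^ 2) volume := by
    simp only [sq_abs]
    exact hu.pow_const 2
  have h2 : AEMeasurable (fun x => |u x| ^ 2 * |β x|) (volume.restrict Ωᶜ) :=
    h1.restrict.mul hβ.norm
  rw [sobolevNormSq, ENNReal.add_lt_top, ENNReal.add_lt_top, and_assoc,
    lintegral_ofReal_lt_top_iff h1.restrict (fun _ => by positivity),
    lintegral_ofReal_lt_top_iff h2 (fun _ => by positivity),
    lintegral_ofReal_lt_top_iff (aemeasurable_quotient s hu).restrict (fun _ => by positivity)]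
  rfl

theorem MemW.memLp (hu : MemW s Ω β u) : MemLp u 2 (volume.restrict Ω) := by
  rw [memLp_two_iff_integrable_sq hu.1.restrict.aestronglyMeasurable]
  have h1 : AEMeasurable (fun x => |u x| ^ 2) volume := by
    simp only [sq_abs]
    exact hu.1.pow_const 2
  have := (lintegral_ofReal_lt_top_iff h1.restrict (fun _ => by positivity)).1
    (lt_of_le_of_lt (le_add_right le_self_add) hu.2 :
      ∫⁻ x in Ω, ENNReal.ofReal (|u x| ^ 2) < ⊤)
  simpa only [sq_abs] using this

theorem sub_prod_congr_ae (h : u =ᵐ[volume] v) :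
    (fun p : EuclideanSpace ℝ (Fin n) × EuclideanSpace ℝ (Fin n) => u p.1 - u p.2) =ᵐ[volume]
      fun p => v p.1 - v p.2 := by
  have h1 := (Measure.quasiMeasurePreserving_fst (μ := (volume : Measure (EuclideanSpace ℝ (Fin n))))
    (ν := (volume : Measure (EuclideanSpace ℝ (Fin n))))).ae_eq_comp h
  have h2 := (Measure.quasiMeasurePreserving_snd (μ := (volume : Measure (EuclideanSpace ℝ (Fin n))))
    (ν := (volume : Measure (EuclideanSpace ℝ (Fin n))))).ae_eq_comp h
  rw [Measure.volume_eq_prod]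
  filter_upwards [h1, h2] with p hp1 hp2
  simp only [Function.comp_apply] at hp1 hp2
  rw [hp1, hp2]

theorem sobolevNormSq_congr_ae (h : u =ᵐ[volume] v) :
    sobolevNormSq s Ω β u = sobolevNormSq s Ω β v := by
  unfold sobolevNormSq
  congr 1
  · congr 1
    · refine lintegral_congr_ae (ae_restrict_of_ae ?_)
      filter_upwards [h] with x hx
      rw [hx]
    · refine lintegral_congr_ae (ae_restrict_of_ae ?_)
      filter_upwards [h] with x hx
      rw [hx]
  · refine lintegral_congr_ae (ae_restrict_of_ae ?_)
    filter_upwards [sub_prod_congr_ae h] with p hp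
    rw [hp]

theorem MemW.congr_ae (hu : MemW s Ω β u) (h : u =ᵐ[volume] v) : MemW s Ω β v :=
  ⟨hu.1.congr h, sobolevNormSq_congr_ae (s := s) (Ω := Ω) (β := β) h ▸ hu.2⟩

theorem sq_abs_add_le (a b : ℝ) : |a + b| ^ 2 ≤ 2 * |a| ^ 2 + 2 * |b| ^ 2 := by
  simp only [sq_abs]
  nlinarith [sq_nonneg (a - b)]

theorem MemW.add (hβ : AEMeasurable β (volume.restrict Ωᶜ)) (hu : MemW s Ω β u)
    (hv : MemW s Ω β v) : MemW s Ω β (u + v) := by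
  rw [memW_iff hβ] at hu hv ⊢
  obtain ⟨hu0, hu1, hu2, hu3⟩ := hu
  obtain ⟨hv0, hv1, hv2, hv3⟩ := hv
  have h0 := hu0.add hv0
  have hsq : AEMeasurable (fun x => |(u + v) x| ^ 2) volume := by
    simp only [sq_abs]
    exact h0.pow_const 2
  refine ⟨h0, ?_, ?_, ?_⟩
  · refine ((hu1.const_mul 2).add (hv1.const_mul 2)).mono' hsq.restrict.aestronglyMeasurable
      (Eventually.of_forall fun x => ?_)
    rw [Real.norm_of_nonneg (by positivity)]
    exact sq_abs_add_le _ _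
  · refine ((hu2.const_mul 2).add (hv2.const_mul 2)).mono'
      (hsq.restrict.mul hβ.norm).aestronglyMeasurable (Eventually.of_forall fun x => ?_)
    rw [Real.norm_of_nonneg (by positivity)]
    have := mul_le_mul_of_nonneg_right (sq_abs_add_le (u x) (v x)) (abs_nonneg (β x))
    simp only [Pi.add_apply]
    linarith
  · refine ((hu3.const_mul 2).add (hv3.const_mul 2)).mono'
      (aemeasurable_quotient s h0).restrict.aestronglyMeasurable (Eventually.of_forall fun p => ?_)
    rw [Real.norm_of_nonneg (by positivity)]
    have := div_le_div_of_nonneg_right (sq_abs_add_le (u p.1 - u p.2) (v p.1 - v p.2))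
      (by positivity : 0 ≤ ‖p.1 - p.2‖ ^ ((n : ℝ) + 2 * s))
    simp only [Pi.add_apply] at this ⊢
    rw [show u p.1 + v p.1 - (u p.2 + v p.2) = u p.1 - u p.2 + (v p.1 - v p.2) by ring]
    calc _ ≤ _ := this
      _ = _ := by ring

theorem MemW.const_smul (hβ : AEMeasurable β (volume.restrict Ωᶜ)) (c : ℝ)
    (hu : MemW s Ω β u) : MemW s Ω β (c • u) := by
  rw [memW_iff hβ] at hu ⊢
  obtain ⟨hu0, hu1, hu2, hu3⟩ := hu
  refine ⟨hu0.const_smul c, ?_, ?_, ?_⟩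
  · refine (hu1.const_mul (c ^ 2)).congr (Eventually.of_forall fun x => ?_)
    simp only [Pi.smul_apply, smul_eq_mul, sq_abs]
    ring
  · refine (hu2.const_mul (c ^ 2)).congr (Eventually.of_forall fun x => ?_)
    simp only [Pi.smul_apply, smul_eq_mul, sq_abs]
    ring
  · refine (hu3.const_mul (c ^ 2)).congr (Eventually.of_forall fun x => ?_)
    simp only [Pi.smul_apply, smul_eq_mul, sq_abs]
    ring

theorem MemW.sub (hβ : AEMeasurable β (volume.restrict Ωᶜ)) (hu : MemW s Ω β u)
    (hv : MemW s Ω β v) : MemW s Ω β (u - v) := by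
  have := hu.add hβ (hv.const_smul hβ (-1))
  rwa [neg_one_smul, ← sub_eq_add_neg] at this

theorem memW_zero : MemW s Ω β 0 := by
  refine ⟨aemeasurable_zero, ?_⟩
  simp [sobolevNormSq]

/-- On the Sobolev space, the energy is an absolutely convergent double integral. -/
theorem robinEnergy_eq (hΩ : MeasurableSet Ω) (hu : MemW s Ω β u) (hv : MemW s Ω β v) :
    robinEnergy s Ω β u v =
      fracConst n s / 2 * (∫ p in crossSet Ω,
        (u p.1 - u p.2) * (v p.1 - v p.2) / ‖p.1 - p.2‖ ^ ((n : ℝ) + 2 * s)) +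
      ∫ x in Ωᶜ, β x * u x * v x := by
  rw [robinEnergy, energy, setIntegral_crossSet hΩ (hu.integrableOn_energy hv) fun p => by
    simp only [Prod.fst_swap, Prod.snd_swap]
    rw [norm_sub_rev]
    ring]
  ring

theorem robinEnergy_comm (u v : EuclideanSpace ℝ (Fin n) → ℝ) :
    robinEnergy s Ω β u v = robinEnergy s Ω β v u := by
  simp only [robinEnergy, energy, mul_comm, mul_left_comm]

theorem robinEnergy_congr_ae (hΩ : MeasurableSet Ω) (hu : MemW s Ω β u) (hv : MemW s Ω β v)
    {u' v' : EuclideanSpace ℝ (Fin n) → ℝ} (hu' : u =ᵐ[volume] u') (hv' : v =ᵐ[volume] v') :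
    robinEnergy s Ω β u v = robinEnergy s Ω β u' v' := by
  rw [robinEnergy_eq hΩ hu hv, robinEnergy_eq hΩ (hu.congr_ae hu') (hv.congr_ae hv')]
  congr 1
  · congr 1
    refine integral_congr_ae (ae_restrict_of_ae ?_)
    filter_upwards [sub_prod_congr_ae hu', sub_prod_congr_ae hv'] with p hp hq
    rw [hp, hq]
  · refine integral_congr_ae (ae_restrict_of_ae ?_)
    filter_upwards [hu', hv'] with x hx hy
    rw [hx, hy]

theorem robinEnergy_add_left (hΩ : MeasurableSet Ω) (hβ : IntegrableOn β Ωᶜ)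
    (hu : MemW s Ω β u) (hv : MemW s Ω β v) (hw : MemW s Ω β w) :
    robinEnergy s Ω β (u + v) w = robinEnergy s Ω β u w + robinEnergy s Ω β v w := by
  have hβm := hβ.aestronglyMeasurable.aemeasurable
  rw [robinEnergy_eq hΩ (hu.add hβm hv) hw, robinEnergy_eq hΩ hu hw, robinEnergy_eq hΩ hv hw]
  have h1 := integral_add (hu.integrableOn_energy hw) (hv.integrableOn_energy hw)
  have h2 := integral_add (hu.integrableOn_exterior hβ hw) (hv.integrableOn_exterior hβ hw)
  have h3 : ∫ p in crossSet Ω, ((u + v) p.1 - (u + v) p.2) * (w p.1 - w p.2) /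
      ‖p.1 - p.2‖ ^ ((n : ℝ) + 2 * s) = _ := Eq.trans (integral_congr_ae
        (Eventually.of_forall fun p => by simp only [Pi.add_apply]; ring)) h1
  have h4 : ∫ x in Ωᶜ, β x * (u + v) x * w x = _ := Eq.trans (integral_congr_ae
        (Eventually.of_forall fun p => by simp only [Pi.add_apply]; ring)) h2
  rw [h3, h4]
  ring

theorem robinEnergy_smul_left (hΩ : MeasurableSet Ω)
    (hβm : AEMeasurable β (volume.restrict Ωᶜ)) (c : ℝ)
    (hu : MemW s Ω β u) (hw : MemW s Ω β w) :
    robinEnergy s Ω β (c • u) w = c * robinEnergy s Ω β u w := by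
  rw [robinEnergy_eq hΩ (hu.const_smul hβm c) hw, robinEnergy_eq hΩ hu hw]
  have e1 : ∫ p in crossSet Ω, ((c • u) p.1 - (c • u) p.2) * (w p.1 - w p.2) /
      ‖p.1 - p.2‖ ^ ((n : ℝ) + 2 * s) = c * ∫ p in crossSet Ω, (u p.1 - u p.2) *
      (w p.1 - w p.2) / ‖p.1 - p.2‖ ^ ((n : ℝ) + 2 * s) := by
    rw [← integral_const_mul]
    refine integral_congr_ae (Eventually.of_forall fun p => ?_)
    simp only [Pi.smul_apply, smul_eq_mul]
    ring
  have e2 : ∫ x in Ωᶜ, β x * (c • u) x * w x = c * ∫ x in Ωᶜ, β x * u x * w x := by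
    rw [← integral_const_mul]
    refine integral_congr_ae (Eventually.of_forall fun p => ?_)
    simp only [Pi.smul_apply, smul_eq_mul]
    ring
  rw [e1, e2]
  ring

/-- The energy of a single function, as an extended nonnegative number. -/
theorem ofReal_robinEnergy_self (hs0 : 0 < s) (hs1 : s < 1) (hΩ : MeasurableSet Ω)
    (hβ : AEMeasurable β (volume.restrict Ωᶜ)) (hβ0 : ∀ᵐ x ∂(volume.restrict Ωᶜ), 0 ≤ β x)
    (hu : MemW s Ω β u) :
    ENNReal.ofReal (robinEnergy s Ω β u u) =
      ENNReal.ofReal (fracConst n s / 2) * (∫⁻ p in crossSet Ω,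
        ENNReal.ofReal (|u p.1 - u p.2| ^ 2 / ‖p.1 - p.2‖ ^ ((n : ℝ) + 2 * s))) +
      ∫⁻ x in Ωᶜ, ENNReal.ofReal (|u x| ^ 2 * |β x|) := by
  have hC := fracConst_pos (n := n) hs0 hs1
  obtain ⟨-, -, h2, h3⟩ := (memW_iff hβ).1 hu
  rw [robinEnergy_eq hΩ hu hu]
  have e1 : ∫ p in crossSet Ω, (u p.1 - u p.2) * (u p.1 - u p.2) /
      ‖p.1 - p.2‖ ^ ((n : ℝ) + 2 * s) = ∫ p in crossSet Ω, |u p.1 - u p.2| ^ 2 /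
      ‖p.1 - p.2‖ ^ ((n : ℝ) + 2 * s) := by simp only [sq_abs, ← sq]
  have e2 : ∫ x in Ωᶜ, β x * u x * u x = ∫ x in Ωᶜ, |u x| ^ 2 * |β x| := by
    refine integral_congr_ae ?_
    filter_upwards [hβ0] with x hx
    rw [sq_abs, abs_of_nonneg hx]
    ring
  rw [e1, e2, ENNReal.ofReal_add, ENNReal.ofReal_mul (by positivity),
    ofReal_integral_eq_lintegral_ofReal h3 (Eventually.of_forall fun _ => by positivity),
    ofReal_integral_eq_lintegral_ofReal h2 (Eventually.of_forall fun _ => by positivity)]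
  · exact mul_nonneg (by positivity) (integral_nonneg fun _ => by positivity)
  · exact integral_nonneg fun _ => by positivity

/-- No membership is required: the integrands are non-negative, and a divergent integral has the
default value 0. -/
theorem robinEnergy_self_nonneg (hs0 : 0 < s) (hs1 : s < 1)
    (hβ0 : ∀ᵐ x ∂(volume.restrict Ωᶜ), 0 ≤ β x) (u : EuclideanSpace ℝ (Fin n) → ℝ) :
    0 ≤ robinEnergy s Ω β u u := by
  have hC := fracConst_pos (n := n) hs0 hs1
  have h : ∀ A B : Set (EuclideanSpace ℝ (Fin n)), 0 ≤ ∫ x in A, ∫ y in B,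
      (u x - u y) * (u x - u y) / ‖x - y‖ ^ ((n : ℝ) + 2 * s) := fun A B =>
    integral_nonneg fun x => integral_nonneg fun y =>
      div_nonneg (mul_self_nonneg _) (by positivity)
  refine add_nonneg (add_nonneg (mul_nonneg (by positivity) (h _ _))
    (mul_nonneg hC.le (h _ _))) (integral_nonneg_of_ae ?_)
  filter_upwards [hβ0] with x hx
  rw [mul_assoc]
  exact mul_nonneg hx (mul_self_nonneg _)

end Sobolev

/-! ### Minimality and orthogonality of the Robin extension -/

section RobinExtension

variable {n : ℕ} {s : ℝ} {Ω : Set (EuclideanSpace ℝ (Fin n))}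
  {β u v w h : EuclideanSpace ℝ (Fin n) → ℝ}

/-- Additivity is claimed only almost everywhere, since the integrals may diverge at points of the
frontier. -/
theorem robinExt_add_ae (hs0 : 0 < s) (hΩ : MeasurableSet Ω) (hfr : volume (frontier Ω) = 0)
    (hu : IntegrableOn u Ω) (hv : IntegrableOn v Ω) :
    robinExt s Ω β (u + v) =ᵐ[volume] robinExt s Ω β u + robinExt s Ω β v := by
  filter_upwards [ae_notMem_closure hfr] with x hx
  rw [Pi.add_apply]
  by_cases hxΩ : x ∈ Ω
  · simp only [robinExt_of_mem hxΩ, Pi.add_apply]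
  · have : potential s Ω (u + v) x = potential s Ω u x + potential s Ω v x := by
      rw [potential, potential, potential, ← integral_add
        (IntegrableOn.div_kernel hs0 hΩ hu (hx hxΩ)) (IntegrableOn.div_kernel hs0 hΩ hv (hx hxΩ))]
      simp only [Pi.add_apply, add_div]
    rw [robinExt_of_notMem hxΩ, robinExt_of_notMem hxΩ, robinExt_of_notMem hxΩ, this, mul_add]

/-- This holds at every point, because a constant leaves an integral without any integrability. -/
theorem robinExt_smul (c : ℝ) : robinExt s Ω β (c • u) = c • robinExt s Ω β u := by
  ext x
  rw [Pi.smul_apply]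
  by_cases hxΩ : x ∈ Ω
  · simp only [robinExt_of_mem hxΩ, Pi.smul_apply]
  · have : potential s Ω (c • u) x = c * potential s Ω u x := by
      rw [potential, potential, ← integral_const_mul]
      simp only [Pi.smul_apply, smul_eq_mul, mul_div_assoc]
    rw [robinExt_of_notMem hxΩ, robinExt_of_notMem hxΩ, this, smul_eq_mul]
    ring

/-- Tonelli's theorem exhibits the exterior energy as an integral over `x` of the density that
`robinExt_minimizes` bounds pointwise. -/
theorem exterior_energy_eq_lintegral (s C : ℝ) (hβ : AEMeasurable β (volume.restrict Ωᶜ))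
    (hw : AEMeasurable w volume) :
    ENNReal.ofReal C * (∫⁻ p in Ωᶜ ×ˢ Ω,
        ENNReal.ofReal (|w p.1 - w p.2| ^ 2 / ‖p.1 - p.2‖ ^ ((n : ℝ) + 2 * s))) +
      (∫⁻ x in Ωᶜ, ENNReal.ofReal (|w x| ^ 2 * |β x|)) =
    ∫⁻ x in Ωᶜ, (ENNReal.ofReal C *
        (∫⁻ y in Ω, ENNReal.ofReal (|w x - w y| ^ 2 / ‖x - y‖ ^ ((n : ℝ) + 2 * s))) +
      ENNReal.ofReal (|w x| ^ 2 * |β x|)) := by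
  have hsq : AEMeasurable (fun x => |w x| ^ 2) volume := by
    simp only [sq_abs]
    exact hw.pow_const 2
  have hext : AEMeasurable (fun x => ENNReal.ofReal (|w x| ^ 2 * |β x|)) (volume.restrict Ωᶜ) :=
    (hsq.restrict.mul hβ.norm).ennreal_ofReal
  have hq : AEMeasurable (fun p : EuclideanSpace ℝ (Fin n) × EuclideanSpace ℝ (Fin n) =>
      ENNReal.ofReal (|w p.1 - w p.2| ^ 2 / ‖p.1 - p.2‖ ^ ((n : ℝ) + 2 * s)))
      ((volume.restrict Ωᶜ).prod (volume.restrict Ω)) := by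
    rw [Measure.prod_restrict, ← Measure.volume_eq_prod]
    exact (aemeasurable_quotient s hw).ennreal_ofReal.restrict
  rw [lintegral_add_right' _ hext, lintegral_const_mul' _ _ ENNReal.ofReal_ne_top,
    Measure.volume_eq_prod, ← Measure.prod_restrict, lintegral_prod _ hq]

/-- The Robin extension of the restriction to `Ω` of an element of `W^{s,2}_{β,Ω}` is in
`W^{s,2}_{β,Ω}`. -/
theorem MemW.robinExt (hs0 : 0 < s) (hs1 : s < 1) (hΩ : MeasurableSet Ω) (hb : volume Ω ≠ ⊤)
    (hfr : volume (frontier Ω) = 0) (hβ : AEMeasurable β (volume.restrict Ωᶜ))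
    (hβ0 : ∀ᵐ x ∂(volume.restrict Ωᶜ), 0 ≤ β x) (hv : MemW s Ω β v) :
    MemW s Ω β (robinExt s Ω β v) := by
  have hC := fracConst_pos (n := n) hs0 hs1
  have hr : AEMeasurable (NonlocalRobin.robinExt s Ω β v) volume :=
    aemeasurable_robinExt hΩ hβ hv.1.restrict
  set r := NonlocalRobin.robinExt s Ω β v with hrdef
  have hrΩ : ∀ y ∈ Ω, r y = v y := fun y hy => robinExt_of_mem hy
  set q : (EuclideanSpace ℝ (Fin n) → ℝ) → EuclideanSpace ℝ (Fin n) × EuclideanSpace ℝ (Fin n) →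
    ENNReal := fun w p =>
      ENNReal.ofReal (|w p.1 - w p.2| ^ 2 / ‖p.1 - p.2‖ ^ ((n : ℝ) + 2 * s)) with hq
  obtain ⟨hv1, hv2⟩ := hv
  have hv2' := hv2
  rw [sobolevNormSq, ENNReal.add_lt_top, ENNReal.add_lt_top] at hv2'
  obtain ⟨⟨hvΩ, hvext⟩, hvcross⟩ := hv2'
  have hle : ENNReal.ofReal (fracConst n s) * (∫⁻ p in Ωᶜ ×ˢ Ω, q r p) +
      (∫⁻ x in Ωᶜ, ENNReal.ofReal (|r x| ^ 2 * |β x|)) ≤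
      ENNReal.ofReal (fracConst n s) * (∫⁻ p in Ωᶜ ×ˢ Ω, q v p) +
      (∫⁻ x in Ωᶜ, ENNReal.ofReal (|v x| ^ 2 * |β x|)) := by
    rw [exterior_energy_eq_lintegral s _ hβ hr, exterior_energy_eq_lintegral s _ hβ hv1]
    refine lintegral_mono_ae ?_
    have hout : ∀ᵐ x ∂(volume.restrict Ωᶜ), x ∉ closure Ω :=
      (ae_restrict_iff' hΩ.compl).2 (ae_notMem_closure hfr)
    filter_upwards [hβ0, hout] with x hβx hx
    have hvL : MemLp v 2 (volume.restrict Ω) := MemW.memLp (β := β) (s := s) ⟨hv1, hv2⟩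
    have key : ∀ t : ℝ, ENNReal.ofReal (fracConst n s) *
        (∫⁻ y in Ω, ENNReal.ofReal (|t - v y| ^ 2 / ‖x - y‖ ^ ((n : ℝ) + 2 * s))) +
        ENNReal.ofReal (|t| ^ 2 * |β x|) = ENNReal.ofReal (fracConst n s *
        (∫ y in Ω, |t - v y| ^ 2 / ‖x - y‖ ^ ((n : ℝ) + 2 * s)) + |t| ^ 2 * |β x|) := fun t => by
      rw [ENNReal.ofReal_add _ (by positivity), ENNReal.ofReal_mul hC.le,
        ofReal_integral_eq_lintegral_ofReal (integrableOn_sq_sub_div_kernel hs0 hΩ hb hvL hx t)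
          (Eventually.of_forall fun _ => by positivity)]
      exact mul_nonneg hC.le (integral_nonneg fun _ => by positivity)
    -- Since `r = v` in `Ω`, only the exterior value changes between the two densities: `t = r x`
    -- against `t = v x`.
    have hcongr : ∫⁻ y in Ω, ENNReal.ofReal (|r x - r y| ^ 2 / ‖x - y‖ ^ ((n : ℝ) + 2 * s)) =
        ∫⁻ y in Ω, ENNReal.ofReal (|r x - v y| ^ 2 / ‖x - y‖ ^ ((n : ℝ) + 2 * s)) :=
      setLIntegral_congr_fun hΩ fun y hy => by simp only [hrΩ y hy]
    rw [hcongr, key, key]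
    exact ENNReal.ofReal_le_ofReal (robinExt_minimizes hs0 hs1 hΩ hb hvL hx hβx (v x))
  have hsub : Ωᶜ ×ˢ Ω ⊆ crossSet Ω := by
    rw [crossSet_eq_union]; exact Set.subset_union_right
  have hsub' : Ω ×ˢ Ω ⊆ crossSet Ω := by
    rw [crossSet_eq_union]; exact Set.subset_union_left.trans Set.subset_union_left
  have hfin := lt_of_le_of_lt hle (ENNReal.add_lt_top.2 ⟨ENNReal.mul_lt_top ENNReal.ofReal_lt_top
    (lt_of_le_of_lt (lintegral_mono_set hsub) hvcross), hvext⟩)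
  rw [ENNReal.add_lt_top] at hfin
  have hrcross : ∫⁻ p in Ωᶜ ×ˢ Ω, q r p < ⊤ :=
    ENNReal.lt_top_of_mul_ne_top_right hfin.1.ne (by simpa using hC)
  refine ⟨hr, ?_⟩
  rw [sobolevNormSq, ENNReal.add_lt_top, ENNReal.add_lt_top]
  refine ⟨⟨?_, hfin.2⟩, lt_of_le_of_lt (setLIntegral_crossSet_le Ω (q r) fun p => ?_) ?_⟩
  · rwa [setLIntegral_congr_fun hΩ fun y hy => by
      show ENNReal.ofReal (|r y| ^ 2) = ENNReal.ofReal (|v y| ^ 2)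
      rw [hrΩ y hy]]
  · simp only [hq, Prod.fst_swap, Prod.snd_swap]
    rw [norm_sub_rev, abs_sub_comm]
  · refine ENNReal.add_lt_top.2 ⟨?_, ENNReal.mul_lt_top (by simp) hrcross⟩
    rw [setLIntegral_congr_fun (g := q v) (hΩ.prod hΩ) fun p hp => by
      simp only [hq, hrΩ _ hp.1, hrΩ _ hp.2]]
    exact lt_of_le_of_lt (lintegral_mono_set hsub') hvcross

/-- Robin extensions are orthogonal, for the energy, to the functions that vanish in `Ω`. -/
theorem robinEnergy_robinExt_eq_zero (hs0 : 0 < s) (hs1 : s < 1) (hΩ : MeasurableSet Ω)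
    (hb : volume Ω ≠ ⊤) (hfr : volume (frontier Ω) = 0)
    (hβ0 : ∀ᵐ x ∂(volume.restrict Ωᶜ), 0 ≤ β x)
    (hu : IntegrableOn u Ω) (hr : MemW s Ω β (robinExt s Ω β u)) (hh : MemW s Ω β h)
    (h0 : h =ᵐ[volume.restrict Ω] 0) :
    robinEnergy s Ω β (robinExt s Ω β u) h = 0 := by
  set r := robinExt s Ω β u with hrdef
  set g : EuclideanSpace ℝ (Fin n) × EuclideanSpace ℝ (Fin n) → ℝ := fun p =>
    (r p.1 - r p.2) * (h p.1 - h p.2) / ‖p.1 - p.2‖ ^ ((n : ℝ) + 2 * s) with hg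
  have hgint : IntegrableOn g (crossSet Ω) := hr.integrableOn_energy hh
  have hin : ∫ x in Ω, ∫ y in Ω, g (x, y) = 0 := by
    refine integral_eq_zero_of_ae ?_
    filter_upwards [h0] with x hx
    refine integral_eq_zero_of_ae ?_
    filter_upwards [h0] with y hy
    simp [hg, hx, hy]
  have hsymm : ∀ p, g p.swap = g p := fun p => by
    simp only [hg, Prod.fst_swap, Prod.snd_swap]
    rw [norm_sub_rev]
    ring
  have hsub : Ωᶜ ×ˢ Ω ⊆ crossSet Ω := by
    rw [crossSet_eq_union]; exact Set.subset_union_right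
  have hsub' : Ω ×ˢ Ωᶜ ⊆ crossSet Ω := by
    rw [crossSet_eq_union]; exact Set.subset_union_right.trans Set.subset_union_left
  -- Fubini makes the exterior point the outer variable, so that the Robin condition can be used
  -- pointwise.
  have hout : ∫ x in Ω, ∫ y in Ωᶜ, g (x, y) = ∫ x in Ωᶜ, ∫ y in Ω, g (x, y) := by
    have e1 := setIntegral_prod g (hgint.mono_set hsub')
    have e2 := setIntegral_prod g (hgint.mono_set hsub)
    rw [← e1, ← e2, ← setIntegral_prod_swap]
    simp only [hsymm]
  have houtcl : ∀ᵐ x ∂(volume.restrict Ωᶜ), x ∉ closure Ω :=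
    (ae_restrict_iff' hΩ.compl).2 (ae_notMem_closure hfr)
  -- As `h` vanishes in `Ω`, the factor `h x` leaves the inner integral, and what remains is the
  -- nonlocal normal derivative of `r`, equal to `-β r`.
  have hfinal : fracConst n s * ∫ x in Ωᶜ, ∫ y in Ω, g (x, y) =
      -∫ x in Ωᶜ, β x * r x * h x := by
    rw [← integral_const_mul, ← integral_neg]
    refine integral_congr_ae ?_
    filter_upwards [hβ0, houtcl] with x hβx hx
    have hcond := nonlocalNormalDeriv_robinExt_add (s := s) hs0 hs1 hΩ hb hu hx hβx
    have e : ∫ y in Ω, g (x, y) =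
        h x * ∫ y in Ω, (r x - r y) / ‖x - y‖ ^ ((n : ℝ) + 2 * s) := by
      rw [← integral_const_mul]
      refine integral_congr_ae ?_
      filter_upwards [h0] with y hy
      simp only [hg, hy, Pi.zero_apply, sub_zero]
      ring
    rw [nonlocalNormalDeriv] at hcond
    rw [e]
    linear_combination h x * hcond
  rw [robinEnergy, energy]
  change fracConst n s / 2 * (∫ x in Ω, ∫ y in Ω, g (x, y)) +
    fracConst n s * (∫ x in Ω, ∫ y in Ωᶜ, g (x, y)) + _ = 0
  rw [hin, hout, hfinal]
  ring

end RobinExtension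

/-! ### Bounded Lipschitz functions belong to the space -/

section Density

variable {n : ℕ} {s : ℝ} {Ω : Set (EuclideanSpace ℝ (Fin n))}
  {β φ : EuclideanSpace ℝ (Fin n) → ℝ}

/-- In polar coordinates the radial integrand is `y^(1-2s)` near 0 and `y^(-1-2s)` at infinity;
these converge because `s < 1` and `s > 0` respectively. -/
theorem integrable_min_one_norm_sq_div (hn : 1 ≤ n) (hs0 : 0 < s) (hs1 : s < 1) :
    Integrable (fun z : EuclideanSpace ℝ (Fin n) =>
      min 1 (‖z‖ ^ 2) / ‖z‖ ^ ((n : ℝ) + 2 * s)) := by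
  have : Nonempty (Fin n) := ⟨⟨0, hn⟩⟩
  refine (integrable_fun_norm_addHaar volume
    (f := fun y : ℝ => min 1 (y ^ 2) / y ^ ((n : ℝ) + 2 * s))).2 ?_
  have hfr : Module.finrank ℝ (EuclideanSpace ℝ (Fin n)) = n := by simp
  have hpow : ∀ y : ℝ, 0 < y → y ^ (n - 1) = y ^ ((n : ℝ) - 1) := fun y hy => by
    rw [← Real.rpow_natCast, Nat.cast_sub hn, Nat.cast_one]
  rw [hfr, ← Set.Ioo_union_Ici_eq_Ioi (zero_lt_one' ℝ)]
  refine IntegrableOn.union ?_ ?_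
  · refine ((intervalIntegral.integrableOn_Ioo_rpow_iff zero_lt_one).2
      (by linarith : -1 < 1 - 2 * s)).congr_fun (fun y hy => ?_) measurableSet_Ioo
    have h1 : min 1 (y ^ 2) = y ^ (2 : ℝ) := by
      rw [min_eq_right (by nlinarith [hy.1, hy.2]), Real.rpow_two]
    simp only [smul_eq_mul]
    rw [h1, hpow y hy.1, ← Real.rpow_sub hy.1, ← Real.rpow_add hy.1]
    congr 1
    ring
  · rw [integrableOn_Ici_iff_integrableOn_Ioi]
    refine (integrableOn_Ioi_rpow_of_lt (by linarith : -1 - 2 * s < -1) zero_lt_one).congr_fun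
      (fun y hy => ?_) measurableSet_Ioi
    have hy1 : (1 : ℝ) < y := hy
    have hy0 : 0 < y := by linarith
    simp only [smul_eq_mul]
    rw [min_eq_left (by nlinarith), hpow y hy0, one_div, ← Real.rpow_neg hy0.le,
      ← Real.rpow_add hy0]
    congr 1
    ring

/-- Bounded Lipschitz functions are in `W^{s,2}_{β,Ω}`. -/
theorem memW_of_lipschitzWith (hn : 1 ≤ n) (hs0 : 0 < s) (hs1 : s < 1)
    (hb : volume Ω ≠ ⊤) (hβ : IntegrableOn β Ωᶜ) {K : NNReal} (hφ : LipschitzWith K φ) {M : ℝ}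
    (hM : ∀ x, |φ x| ≤ M) : MemW s Ω β φ := by
  have hφm : Measurable φ := hφ.continuous.measurable
  have hφ2 : ∀ x, |φ x| ^ 2 ≤ M ^ 2 := fun x => by gcongr; exact hM x
  have hM0 : 0 ≤ M := (abs_nonneg _).trans (hM 0)
  refine ⟨hφm.aemeasurable, ?_⟩
  rw [sobolevNormSq, ENNReal.add_lt_top, ENNReal.add_lt_top]
  refine ⟨⟨?_, ?_⟩, ?_⟩
  · calc _ ≤ ∫⁻ _ in Ω, ENNReal.ofReal (M ^ 2) :=
        lintegral_mono fun x => ENNReal.ofReal_le_ofReal (hφ2 x)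
      _ < ⊤ := by
        rw [setLIntegral_const]
        exact ENNReal.mul_lt_top ENNReal.ofReal_lt_top hb.lt_top
  · have hi : Integrable (fun x => M ^ 2 * |β x|) (volume.restrict Ωᶜ) := hβ.abs.const_mul _
    refine lt_of_le_of_lt (lintegral_mono fun x => ENNReal.ofReal_le_ofReal
      (mul_le_mul_of_nonneg_right (hφ2 x) (abs_nonneg (β x)))) ?_
    exact (lintegral_ofReal_lt_top_iff hi.aestronglyMeasurable.aemeasurable
      fun _ => by positivity).2 hi
  -- The squared difference is at most both `(2M)²` and `K² ‖x - y‖²`, hence at most the sum of the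
  -- two constants times `min 1 (‖x - y‖²)`.
  · set B : ℝ := 4 * M ^ 2 + (K : ℝ) ^ 2 with hB
    set k : EuclideanSpace ℝ (Fin n) → ℝ := fun z =>
      B * (min 1 (‖z‖ ^ 2) / ‖z‖ ^ ((n : ℝ) + 2 * s)) with hk
    have hk0 : ∀ z, 0 ≤ k z := fun z => by simp only [hk]; positivity
    have hkm : Measurable k := by simp only [hk]; fun_prop
    have hkint : ∫⁻ z, ENNReal.ofReal (k z) < ⊤ :=
      (lintegral_ofReal_lt_top_iff hkm.aemeasurable hk0).2
        ((integrable_min_one_norm_sq_div hn hs0 hs1).const_mul B)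
    have hle : ∀ x y, |φ x - φ y| ^ 2 / ‖x - y‖ ^ ((n : ℝ) + 2 * s) ≤ k (x - y) := fun x y => by
      simp only [hk]
      rw [mul_div_assoc']
      gcongr
      have h1 : |φ x - φ y| ≤ 2 * M := by
        calc _ ≤ |φ x| + |φ y| := abs_sub _ _
          _ ≤ _ := by linarith [hM x, hM y]
      have h2 : |φ x - φ y| ≤ K * ‖x - y‖ := by
        simpa [Real.dist_eq, dist_eq_norm] using hφ.dist_le_mul x y
      have h3 : |φ x - φ y| ^ 2 ≤ (2 * M) ^ 2 := by gcongr
      have h4 : |φ x - φ y| ^ 2 ≤ (K * ‖x - y‖) ^ 2 := by gcongr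
      have h5 : 0 ≤ M ^ 2 * ‖x - y‖ ^ 2 := by positivity
      rcases min_cases (1 : ℝ) (‖x - y‖ ^ 2) with ⟨e, _⟩ | ⟨e, _⟩ <;> rw [e] <;>
        nlinarith [sq_nonneg M, sq_nonneg (K : ℝ)]
    -- Up to a swap, every pair in `crossSet Ω` has its second point in `Ω`. With the first point
    -- free, translation invariance leaves `volume Ω` times the integral of `k`.
    have hmain : ∫⁻ p in Set.univ ×ˢ Ω, ENNReal.ofReal (|φ p.1 - φ p.2| ^ 2 /
        ‖p.1 - p.2‖ ^ ((n : ℝ) + 2 * s)) < ⊤ := by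
      calc _ ≤ ∫⁻ p in Set.univ ×ˢ Ω, ENNReal.ofReal (k (p.1 - p.2)) :=
            lintegral_mono fun p => ENNReal.ofReal_le_ofReal (hle _ _)
        _ = ∫⁻ _ in Ω, ∫⁻ z, ENNReal.ofReal (k z) := by
          rw [Measure.volume_eq_prod, ← Measure.prod_restrict, Measure.restrict_univ,
            lintegral_prod_symm _ (by fun_prop)]
          refine lintegral_congr fun y => ?_
          exact lintegral_sub_right_eq_self (fun z => ENNReal.ofReal (k z)) y
        _ < ⊤ := by
          rw [setLIntegral_const]
          exact ENNReal.mul_lt_top hkint hb.lt_top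
    have hset : ∀ A : Set (EuclideanSpace ℝ (Fin n)), ∫⁻ p in A ×ˢ Ω,
        ENNReal.ofReal (|φ p.1 - φ p.2| ^ 2 / ‖p.1 - p.2‖ ^ ((n : ℝ) + 2 * s)) < ⊤ := fun A =>
      lt_of_le_of_lt (lintegral_mono_set (Set.prod_mono (Set.subset_univ _) le_rfl)) hmain
    refine lt_of_le_of_lt (setLIntegral_crossSet_le Ω _ fun p => ?_)
      (ENNReal.add_lt_top.2 ⟨hset Ω, ENNReal.mul_lt_top (by simp) (hset Ωᶜ)⟩)
    simp only [Prod.fst_swap, Prod.snd_swap]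
    rw [norm_sub_rev, abs_sub_comm]

end Density

/-- Fatou's lemma; an eventual bound is enough for the lower limit. -/
theorem lintegral_le_of_tendsto_of_forall_le {α : Type*} [MeasurableSpace α] {μ : Measure α}
    {f : ℕ → α → ENNReal} {g : α → ENNReal} {c : ENNReal} (hf : ∀ j, AEMeasurable (f j) μ)
    (hlim : ∀ᵐ x ∂μ, Tendsto (fun j => f j x) atTop (𝓝 (g x)))
    (hle : ∀ᶠ j in atTop, ∫⁻ x, f j x ∂μ ≤ c) : ∫⁻ x, g x ∂μ ≤ c := by
  calc ∫⁻ x, g x ∂μ = ∫⁻ x, liminf (fun j => f j x) atTop ∂μ := by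
        refine lintegral_congr_ae ?_
        filter_upwards [hlim] with x hx
        exact hx.liminf_eq.symm
    _ ≤ liminf (fun j => ∫⁻ x, f j x ∂μ) atTop := lintegral_liminf_le' hf
    _ ≤ c := liminf_le_of_frequently_le' hle.frequently

/-! ### The Robin form: closedness, density and weak solutions -/

section Closed

variable {n : ℕ} {s : ℝ} {Ω : Set (EuclideanSpace ℝ (Fin n))}
  {β : EuclideanSpace ℝ (Fin n) → ℝ}

theorem memLp_fun (u : L2 Ω) : MemLp u 2 (volume.restrict Ω) := Lp.memLp u

theorem integrableOn_fun (hb : volume Ω ≠ ⊤) (u : L2 Ω) : IntegrableOn u Ω := by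
  have : IsFiniteMeasure ((volume : Measure (EuclideanSpace ℝ (Fin n))).restrict Ω) :=
    ⟨by simpa using hb.lt_top⟩
  exact (memLp_fun u).integrable (by norm_num)

theorem aemeasurable_robinExt_fun (hΩ : MeasurableSet Ω)
    (hβ : AEMeasurable β (volume.restrict Ωᶜ)) (u : L2 Ω) :
    AEMeasurable (robinExt s Ω β u) volume :=
  aemeasurable_robinExt hΩ hβ (memLp_fun u).1.aemeasurable

theorem tendsto_potential (hs0 : 0 < s) (hΩ : MeasurableSet Ω) (hb : volume Ω ≠ ⊤)
    {x : EuclideanSpace ℝ (Fin n)} (hx : x ∉ closure Ω) {g : ℕ → L2 Ω} {w : L2 Ω}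
    (h : Tendsto g atTop (𝓝 w)) :
    Tendsto (fun j => potential s Ω (g j) x) atTop (𝓝 (potential s Ω w x)) := by
  have hk := memLp_kernel hs0 hΩ hb hx
  have hinner : ∀ u : L2 Ω, potential s Ω u x = inner ℝ hk.toLp u := fun u => by
    rw [L2.inner_def]
    refine integral_congr_ae ?_
    filter_upwards [hk.coeFn_toLp] with y hy
    rw [hy]
    simp [div_eq_mul_inv]
  simp only [hinner]
  exact tendsto_const_nhds.inner h

/-- Almost everywhere convergence is needed only in `Ω`: outside, the extension is a weak functional
of `u`, so `L²` convergence gives the limit at every point off the closure. -/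
theorem tendsto_robinExt_ae (hs0 : 0 < s) (hΩ : MeasurableSet Ω) (hb : volume Ω ≠ ⊤)
    (hfr : volume (frontier Ω) = 0) {g : ℕ → L2 Ω} {w : L2 Ω} (h : Tendsto g atTop (𝓝 w))
    (hae : ∀ᵐ x ∂(volume.restrict Ω), Tendsto (fun j => g j x) atTop (𝓝 (w x))) :
    ∀ᵐ x, Tendsto (fun j => robinExt s Ω β (g j) x) atTop (𝓝 (robinExt s Ω β w x)) := by
  filter_upwards [ae_notMem_closure hfr, (ae_restrict_iff' hΩ).1 hae] with x hx hxΩ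
  by_cases hmem : x ∈ Ω
  · simpa only [robinExt_of_mem hmem] using hxΩ hmem
  · simp only [robinExt_of_notMem hmem]
    exact (tendsto_potential hs0 hΩ hb (hx hmem) h).const_mul _

/-- Lower semicontinuity of the Robin energy under convergence in `L²(Ω)`. -/
theorem robinEnergy_le_of_tendsto (hs0 : 0 < s) (hs1 : s < 1) (hΩ : MeasurableSet Ω)
    (hb : volume Ω ≠ ⊤) (hfr : volume (frontier Ω) = 0)
    (hβ : AEMeasurable β (volume.restrict Ωᶜ)) (hβ0 : ∀ᵐ x ∂(volume.restrict Ωᶜ), 0 ≤ β x)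
    {g : ℕ → L2 Ω} {w : L2 Ω} (hg : Tendsto g atTop (𝓝 w)) {ε : ℝ} (hε : 0 ≤ ε)
    (hle : ∀ᶠ j in atTop, MemW s Ω β (robinExt s Ω β (g j)) ∧
      robinEnergy s Ω β (robinExt s Ω β (g j)) (robinExt s Ω β (g j)) ≤ ε) :
    MemW s Ω β (robinExt s Ω β w) ∧
      robinEnergy s Ω β (robinExt s Ω β w) (robinExt s Ω β w) ≤ 2 * ε := by
  have hC : 0 < fracConst n s / 2 := by linarith [fracConst_pos (n := n) hs0 hs1]
  -- Convergence in `L²(Ω)` gives a.e. convergence only along a subsequence, which is all that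
  -- Fatou's lemma needs.
  obtain ⟨ψ, hψ, hae⟩ := (tendstoInMeasure_of_tendsto_Lp hg).exists_seq_tendsto_ae
  set r : ℕ → EuclideanSpace ℝ (Fin n) → ℝ := fun j => robinExt s Ω β (g (ψ j)) with hr
  set r₀ := robinExt s Ω β w with hr₀
  have hlim : ∀ᵐ x, Tendsto (fun j => r j x) atTop (𝓝 (r₀ x)) :=
    tendsto_robinExt_ae hs0 hΩ hb hfr (hg.comp hψ.tendsto_atTop) hae
  have hrm : ∀ j, AEMeasurable (r j) volume := fun j => aemeasurable_robinExt_fun hΩ hβ _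
  have hr₀m : AEMeasurable r₀ volume := aemeasurable_robinExt_fun hΩ hβ w
  have hle' : ∀ᶠ j in atTop, ENNReal.ofReal (fracConst n s / 2) * (∫⁻ p in crossSet Ω,
        ENNReal.ofReal (|r j p.1 - r j p.2| ^ 2 / ‖p.1 - p.2‖ ^ ((n : ℝ) + 2 * s))) +
      ∫⁻ x in Ωᶜ, ENNReal.ofReal (|r j x| ^ 2 * |β x|) ≤ ENNReal.ofReal ε := by
    filter_upwards [hψ.tendsto_atTop.eventually hle] with j hj
    rw [← ofReal_robinEnergy_self hs0 hs1 hΩ hβ hβ0 hj.1]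
    exact ENNReal.ofReal_le_ofReal hj.2
  -- The exterior term and the double integral are each bounded by the whole energy and passed to
  -- the limit separately, hence the constant `2 * ε`.
  have hext : ∫⁻ x in Ωᶜ, ENNReal.ofReal (|r₀ x| ^ 2 * |β x|) ≤ ENNReal.ofReal ε := by
    refine lintegral_le_of_tendsto_of_forall_le
      (f := fun j x => ENNReal.ofReal (|r j x| ^ 2 * |β x|)) (fun j => ?_) ?_ ?_
    · simp only [sq_abs]
      exact (((hrm j).pow_const 2).restrict.mul hβ.norm).ennreal_ofReal
    · filter_upwards [ae_restrict_of_ae hlim] with x hx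
      exact ENNReal.tendsto_ofReal ((hx.abs.pow 2).mul_const _)
    · filter_upwards [hle'] with j hj
      exact le_trans le_add_self hj
  have hCpos : ENNReal.ofReal (fracConst n s / 2) ≠ 0 := by simpa using hC
  have hcross : ∫⁻ p in crossSet Ω, ENNReal.ofReal (|r₀ p.1 - r₀ p.2| ^ 2 /
      ‖p.1 - p.2‖ ^ ((n : ℝ) + 2 * s)) ≤ ENNReal.ofReal ε / ENNReal.ofReal (fracConst n s / 2) := by
    refine lintegral_le_of_tendsto_of_forall_le (f := fun j p => ENNReal.ofReal
      (|r j p.1 - r j p.2| ^ 2 / ‖p.1 - p.2‖ ^ ((n : ℝ) + 2 * s))) (fun j => ?_) ?_ ?_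
    · exact (aemeasurable_quotient s (hrm j)).ennreal_ofReal.restrict
    · have h1 := (Measure.quasiMeasurePreserving_fst
        (μ := (volume : Measure (EuclideanSpace ℝ (Fin n))))
        (ν := (volume : Measure (EuclideanSpace ℝ (Fin n))))).ae hlim
      have h2 := (Measure.quasiMeasurePreserving_snd
        (μ := (volume : Measure (EuclideanSpace ℝ (Fin n))))
        (ν := (volume : Measure (EuclideanSpace ℝ (Fin n))))).ae hlim
      rw [← Measure.volume_eq_prod] at h1 h2
      filter_upwards [ae_restrict_of_ae h1, ae_restrict_of_ae h2] with p hp1 hp2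
      exact ENNReal.tendsto_ofReal (((hp1.sub hp2).abs.pow 2).div_const _)
    · filter_upwards [hle'] with j hj
      rw [ENNReal.le_div_iff_mul_le (Or.inl hCpos) (Or.inl ENNReal.ofReal_ne_top), mul_comm]
      exact le_trans le_self_add hj
  have hmem : MemW s Ω β r₀ := by
    refine ⟨hr₀m, ?_⟩
    rw [sobolevNormSq, ENNReal.add_lt_top, ENNReal.add_lt_top]
    refine ⟨⟨?_, hext.trans_lt ENNReal.ofReal_lt_top⟩,
      hcross.trans_lt (ENNReal.div_lt_top ENNReal.ofReal_ne_top hCpos)⟩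
    have hsq : Integrable (fun x => |w x| ^ 2) (volume.restrict Ω) := by
      simpa only [sq_abs] using (memLp_fun w).integrable_sq
    rw [setLIntegral_congr_fun (g := fun x => ENNReal.ofReal (|w x| ^ 2)) hΩ fun x hx => by
      simp only [hr₀, robinExt_of_mem hx]]
    exact (lintegral_ofReal_lt_top_iff hsq.aestronglyMeasurable.aemeasurable
      fun _ => by positivity).2 hsq
  refine ⟨hmem, ?_⟩
  rw [← ENNReal.ofReal_le_ofReal_iff (by positivity),
    ofReal_robinEnergy_self hs0 hs1 hΩ hβ hβ0 hmem, two_mul ε, ENNReal.ofReal_add hε hε]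
  refine add_le_add ?_ hext
  calc _ ≤ ENNReal.ofReal (fracConst n s / 2) *
        (ENNReal.ofReal ε / ENNReal.ofReal (fracConst n s / 2)) := by gcongr
    _ = _ := ENNReal.mul_div_cancel hCpos ENNReal.ofReal_ne_top

theorem robinExt_coe_add_ae (hs0 : 0 < s) (hΩ : MeasurableSet Ω) (hb : volume Ω ≠ ⊤)
    (hfr : volume (frontier Ω) = 0) (u v : L2 Ω) :
    robinExt s Ω β (u + v : L2 Ω) =ᵐ[volume] robinExt s Ω β u + robinExt s Ω β v :=
  (robinExt_congr_ae hΩ (Lp.coeFn_add u v)).trans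
    (robinExt_add_ae hs0 hΩ hfr (integrableOn_fun hb u) (integrableOn_fun hb v))

theorem robinExt_coe_smul_ae (hΩ : MeasurableSet Ω) (c : ℝ) (u : L2 Ω) :
    robinExt s Ω β (c • u : L2 Ω) =ᵐ[volume] c • robinExt s Ω β u := by
  rw [← robinExt_smul]
  exact robinExt_congr_ae hΩ (Lp.coeFn_smul c u)

/-- The domain of the Robin form. -/
def robinDomain (hs0 : 0 < s) (hΩ : MeasurableSet Ω) (hb : volume Ω ≠ ⊤)
    (hfr : volume (frontier Ω) = 0) (hβ : IntegrableOn β Ωᶜ) :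
    Submodule ℝ (L2 Ω) where
  carrier := {u | MemW s Ω β (robinExt s Ω β u)}
  add_mem' {u v} hu hv :=
    (MemW.add hβ.aestronglyMeasurable.aemeasurable hu hv).congr_ae (robinExt_coe_add_ae hs0 hΩ hb hfr u v).symm
  zero_mem' := by
    have := robinExt_coe_smul_ae (s := s) (β := β) hΩ 0 (0 : L2 Ω)
    rw [zero_smul, zero_smul] at this
    exact memW_zero.congr_ae this.symm
  smul_mem' c u hu := (MemW.const_smul hβ.aestronglyMeasurable.aemeasurable c hu).congr_ae
    (robinExt_coe_smul_ae hΩ c u).symm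

variable {hs0 : 0 < s} {hΩ : MeasurableSet Ω} {hb : volume Ω ≠ ⊤} {hfr : volume (frontier Ω) = 0}

/-- The Robin form. -/
noncomputable def robinForm (hs0 : 0 < s) (hΩ : MeasurableSet Ω) (hb : volume Ω ≠ ⊤)
    (hfr : volume (frontier Ω) = 0) (hβ : IntegrableOn β Ωᶜ) :
    LinearMap.BilinForm ℝ (robinDomain hs0 hΩ hb hfr hβ) :=
  have hadd : ∀ u v w : robinDomain hs0 hΩ hb hfr hβ,
      robinEnergy s Ω β (robinExt s Ω β (u + v : L2 Ω)) (robinExt s Ω β (w : L2 Ω)) =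
      robinEnergy s Ω β (robinExt s Ω β (u : L2 Ω)) (robinExt s Ω β (w : L2 Ω)) +
      robinEnergy s Ω β (robinExt s Ω β (v : L2 Ω)) (robinExt s Ω β (w : L2 Ω)) := fun u v w => by
    rw [← robinEnergy_add_left hΩ hβ u.2 v.2 w.2]
    exact robinEnergy_congr_ae hΩ (u + v).2 w.2
      (robinExt_coe_add_ae hs0 hΩ hb hfr (u : L2 Ω) (v : L2 Ω)) EventuallyEq.rfl
  have hsmul : ∀ (c : ℝ) (u w : robinDomain hs0 hΩ hb hfr hβ),
      robinEnergy s Ω β (robinExt s Ω β (c • u : L2 Ω)) (robinExt s Ω β (w : L2 Ω)) =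
      c * robinEnergy s Ω β (robinExt s Ω β (u : L2 Ω)) (robinExt s Ω β (w : L2 Ω)) :=
    fun c u w => by
    rw [← robinEnergy_smul_left hΩ hβ.aestronglyMeasurable.aemeasurable c u.2 w.2]
    exact robinEnergy_congr_ae hΩ (c • u).2 w.2 (robinExt_coe_smul_ae hΩ c (u : L2 Ω))
      EventuallyEq.rfl
  LinearMap.mk₂ ℝ (fun u v => robinEnergy s Ω β (robinExt s Ω β (u : L2 Ω))
      (robinExt s Ω β (v : L2 Ω)))
    hadd hsmul
    (fun u v w => by
      rw [robinEnergy_comm, robinEnergy_comm (robinExt s Ω β (u : L2 Ω)),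
        robinEnergy_comm (robinExt s Ω β (u : L2 Ω))]
      exact hadd v w u)
    (fun c u v => by
      rw [robinEnergy_comm, robinEnergy_comm (robinExt s Ω β (u : L2 Ω))]
      exact hsmul c v u)

theorem robinForm_apply (hβ : IntegrableOn β Ωᶜ)
    (u v : robinDomain hs0 hΩ hb hfr hβ) :
    robinForm hs0 hΩ hb hfr hβ u v =
      robinEnergy s Ω β (robinExt s Ω β (u : L2 Ω)) (robinExt s Ω β (v : L2 Ω)) := rfl

/-- The sequence is Cauchy in `L²(Ω)`, with a limit `w`. Lower semicontinuity applied to `u m - u k`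
as `k → ∞` with `m` fixed puts `u m - w` in the domain with small energy; subtracting it from `u m`
puts `w` there. -/
theorem isClosedForm_robinForm (hs1 : s < 1) (hβ : IntegrableOn β Ωᶜ)
    (hβ0 : ∀ᵐ x ∂(volume.restrict Ωᶜ), 0 ≤ β x) :
    IsClosedForm _ (robinForm hs0 hΩ hb hfr hβ) := by
  intro lam hlam u hu
  have hβm := hβ.aestronglyMeasurable.aemeasurable
  set a := robinForm hs0 hΩ hb hfr hβ with ha
  have hann : ∀ v, 0 ≤ a v v := fun v => robinEnergy_self_nonneg hs0 hs1 hβ0 _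
  have hcauchy : CauchySeq fun k => (u k : L2 Ω) := by
    rw [cauchySeq_iff_tendsto_dist_atTop_0]
    have h1 : Tendsto (fun p : ℕ × ℕ => ‖(u p.1 : L2 Ω) - u p.2‖ ^ 2) atTop (𝓝 0) := by
      refine squeeze_zero (fun _ => by positivity) (fun p => ?_)
        (by simpa only [mul_zero] using hu.const_mul lam⁻¹)
      have := hann (u p.1 - u p.2)
      rw [real_inner_self_eq_norm_sq, mul_add, inv_mul_cancel_left₀ hlam.ne']
      have h2 : 0 ≤ lam⁻¹ * a (u p.1 - u p.2) (u p.1 - u p.2) := by positivity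
      calc _ = ‖u p.1 - u p.2‖ ^ 2 := rfl
        _ ≤ _ := by linarith
    have := h1.sqrt
    simpa [dist_eq_norm, Real.sqrt_sq] using this
  obtain ⟨w, hw⟩ := cauchySeq_tendsto_of_complete hcauchy
  have hclaim : ∀ ε > 0, ∃ N, ∀ m ≥ N, MemW s Ω β (robinExt s Ω β ((u m : L2 Ω) - w : L2 Ω)) ∧
      robinEnergy s Ω β (robinExt s Ω β ((u m : L2 Ω) - w : L2 Ω))
        (robinExt s Ω β ((u m : L2 Ω) - w : L2 Ω)) ≤ 2 * ε := by
    intro ε hε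
    obtain ⟨N, hN⟩ := eventually_atTop_prod_self'.1 (hu.eventually_lt_const hε)
    refine ⟨N, fun m hm => robinEnergy_le_of_tendsto hs0 hs1 hΩ hb hfr hβm hβ0
      (tendsto_const_nhds.sub hw) hε.le ?_⟩
    filter_upwards [eventually_ge_atTop N] with k hk
    refine ⟨(u m - u k).2, ?_⟩
    have h1 := hN m hm k hk
    have h2 : 0 ≤ lam * inner ℝ (u m - u k) (u m - u k) :=
      mul_nonneg hlam.le real_inner_self_nonneg
    calc _ = a (u m - u k) (u m - u k) := rfl
      _ ≤ ε := by linarith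
  have hwD : w ∈ robinDomain hs0 hΩ hb hfr hβ := by
    obtain ⟨N, hN⟩ := hclaim 1 one_pos
    have h1 : (u N : L2 Ω) - w ∈ robinDomain hs0 hΩ hb hfr hβ := (hN N le_rfl).1
    simpa using Submodule.sub_mem _ (u N).2 h1
  refine ⟨⟨w, hwD⟩, ?_⟩
  have hform : Tendsto (fun k => a (u k - ⟨w, hwD⟩) (u k - ⟨w, hwD⟩)) atTop (𝓝 0) := by
    rw [Metric.tendsto_atTop]
    intro ε hε
    -- With the factor 2 of `hclaim` this gives `ε / 2`, strictly below `ε`.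
    obtain ⟨N, hN⟩ := hclaim (ε / 4) (by positivity)
    refine ⟨N, fun k hk => ?_⟩
    have h1 : a (u k - ⟨w, hwD⟩) (u k - ⟨w, hwD⟩) ≤ 2 * (ε / 4) := (hN k hk).2
    rw [Real.dist_eq, sub_zero, abs_of_nonneg (hann _)]
    linarith
  have hnorm : Tendsto (fun k => inner ℝ (u k - ⟨w, hwD⟩) (u k - ⟨w, hwD⟩)) atTop (𝓝 (0 : ℝ)) := by
    have h1 := (tendsto_iff_norm_sub_tendsto_zero.1 hw).pow 2
    rw [zero_pow two_ne_zero] at h1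
    refine h1.congr fun k => ?_
    rw [real_inner_self_eq_norm_sq]
    rfl
  simpa only [mul_zero, add_zero] using hform.add (hnorm.const_mul lam)

/-- The restriction to `Ω` of an element of `W^{s,2}_{β,Ω}` is in the domain of the Robin form. -/
theorem MemW.toLp_mem_robinDomain (hs1 : s < 1) (hβ : IntegrableOn β Ωᶜ)
    (hβ0 : ∀ᵐ x ∂(volume.restrict Ωᶜ), 0 ≤ β x) {v : EuclideanSpace ℝ (Fin n) → ℝ}
    (hv : MemW s Ω β v) : hv.memLp.toLp ∈ robinDomain hs0 hΩ hb hfr hβ :=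
  (hv.robinExt hs0 hs1 hΩ hb hfr hβ.aestronglyMeasurable.aemeasurable hβ0).congr_ae
    (robinExt_congr_ae hΩ hv.memLp.coeFn_toLp.symm)

/-- Smooth functions with compact support in `ℝⁿ`, not necessarily in `Ω`, approximate in `L²(Ω)`.
They are bounded and Lipschitz, so their restrictions lie in the domain. -/
theorem dense_robinDomain (hn : 1 ≤ n) (hs1 : s < 1) (hβ : IntegrableOn β Ωᶜ)
    (hβ0 : ∀ᵐ x ∂(volume.restrict Ωᶜ), 0 ≤ β x) :
    Dense (robinDomain hs0 hΩ hb hfr hβ : Set (L2 Ω)) := by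
  rw [Metric.dense_iff]
  intro u ε hε
  obtain ⟨φ, hφc, hφs, hφ⟩ := (memLp_fun u).exist_eLpNorm_sub_le (by norm_num) (by norm_num)
    (half_pos hε)
  obtain ⟨K, hK⟩ := hφs.lipschitzWith_of_hasCompactSupport hφc (by simp)
  obtain ⟨M, hM⟩ := hφc.exists_bound_of_continuous hφs.continuous
  have hmem : MemW s Ω β φ := memW_of_lipschitzWith hn hs0 hs1 hb hβ hK hM
  refine ⟨hmem.memLp.toLp, ?_, hmem.toLp_mem_robinDomain hs1 hβ hβ0⟩
  rw [Metric.mem_ball, dist_comm, Lp.dist_def, eLpNorm_congr_ae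
    (EventuallyEq.rfl.sub hmem.memLp.coeFn_toLp)]
  calc _ ≤ (ENNReal.ofReal (ε / 2)).toReal := ENNReal.toReal_mono ENNReal.ofReal_ne_top hφ
    _ < ε := by rw [ENNReal.toReal_ofReal (by positivity)]; linarith

theorem inner_eq_setIntegral (f g : L2 Ω) : inner ℝ f g = ∫ x in Ω, f x * g x := by
  rw [L2.inner_def]
  simp [mul_comm]

/-- The Robin form represents `f` at `u` if and only if the Robin extension of `u` is a weak
solution of the exterior value problem with right-hand side `f`. -/
theorem exists_robinForm_eq_iff_isWeakRobinSolution (hs1 : s < 1) (hβ : IntegrableOn β Ωᶜ)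
    (hβ0 : ∀ᵐ x ∂(volume.restrict Ωᶜ), 0 ≤ β x) (u f : L2 Ω) :
    (∃ hu : u ∈ robinDomain hs0 hΩ hb hfr hβ, ∀ v : robinDomain hs0 hΩ hb hfr hβ,
      robinForm hs0 hΩ hb hfr hβ ⟨u, hu⟩ v = inner ℝ f (v : L2 Ω)) ↔
      IsWeakRobinSolution s Ω β f (robinExt s Ω β u) := by
  have hβm := hβ.aestronglyMeasurable.aemeasurable
  constructor
  · rintro ⟨hu, h⟩
    refine ⟨hu, fun v hv => ?_⟩
    have hv' := hv.toLp_mem_robinDomain (hs0 := hs0) (hΩ := hΩ) (hb := hb) (hfr := hfr) hs1 hβ hβ0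
    -- Split `v = (v - r) + r`: the first term vanishes a.e. in `Ω` and is orthogonal to `robinExt s
    -- Ω β u`, the second is an extension that the form can test.
    set r := robinExt s Ω β (hv.memLp.toLp : L2 Ω) with hr
    have hrW : MemW s Ω β r := hv'
    have hrv : r =ᵐ[volume.restrict Ω] v :=
      (robinExt_ae_eq hΩ).trans hv.memLp.coeFn_toLp
    have hort : robinEnergy s Ω β (robinExt s Ω β u) (v - r) = 0 := by
      refine robinEnergy_robinExt_eq_zero hs0 hs1 hΩ hb hfr hβ0 (integrableOn_fun hb u) hu
        (hv.sub hβm hrW) ?_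
      filter_upwards [hrv] with x hx
      simp [hx]
    have hsplit : robinEnergy s Ω β (robinExt s Ω β u) v =
        robinEnergy s Ω β (robinExt s Ω β u) r := by
      have h1 := robinEnergy_add_left hΩ hβ (hv.sub hβm hrW) hrW hu
      rw [sub_add_cancel, robinEnergy_comm v, robinEnergy_comm (v - r), hort, zero_add,
        robinEnergy_comm r] at h1
      exact h1
    rw [hsplit]
    refine (h ⟨_, hv'⟩).trans ?_
    rw [inner_eq_setIntegral]
    refine integral_congr_ae ?_
    filter_upwards [hv.memLp.coeFn_toLp] with x hx
    rw [hx]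
  -- Conversely, the extension of a domain element is itself an admissible test function, and it
  -- agrees with that element in `Ω`.
  · rintro ⟨hu, h⟩
    refine ⟨hu, fun v => ?_⟩
    rw [robinForm_apply, h _ v.2, inner_eq_setIntegral]
    refine integral_congr_ae ?_
    filter_upwards [robinExt_ae_eq (s := s) (β := β) (u := (v : L2 Ω)) hΩ] with x hx
    rw [hx]

end Closed

end NonlocalRobin

theorem theorem3p11 (n : ℕ) (hn : 1 ≤ n) (s : ℝ) (hs0 : 0 < s) (hs1 : s < 1)
    (Ω : Set (EuclideanSpace ℝ (Fin n))) (hΩ : IsOpen Ω) (hΩb : Bornology.IsBounded Ω)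
    (hΩL : NonlocalRobin.HasLipschitzBoundary Ω)
    (β : EuclideanSpace ℝ (Fin n) → ℝ) (hβ : IntegrableOn β Ωᶜ)
    (hβ0 : ∀ᵐ x ∂(volume.restrict Ωᶜ), 0 ≤ β x) :
    ∃ (D : Submodule ℝ (NonlocalRobin.L2 Ω)) (a : LinearMap.BilinForm ℝ D),
      (∀ u : NonlocalRobin.L2 Ω,
        u ∈ D ↔ NonlocalRobin.MemW s Ω β (NonlocalRobin.robinExt s Ω β u)) ∧
      (∀ u v : D, a u v = NonlocalRobin.robinEnergy s Ω β
        (NonlocalRobin.robinExt s Ω β (u : NonlocalRobin.L2 Ω))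
        (NonlocalRobin.robinExt s Ω β (v : NonlocalRobin.L2 Ω))) ∧
      (∀ u v : D, a u v = a v u) ∧
      (∀ u : D, 0 ≤ a u u) ∧
      Dense (D : Set (NonlocalRobin.L2 Ω)) ∧
      NonlocalRobin.IsClosedForm D a ∧
      (∀ u : NonlocalRobin.L2 Ω, ∀ᵐ x ∂(volume.restrict (closure Ω)ᶜ),
        NonlocalRobin.nonlocalNormalDeriv s Ω (NonlocalRobin.robinExt s Ω β u) x +
          β x * NonlocalRobin.robinExt s Ω β u x = 0) ∧
      ∃ A : NonlocalRobin.L2 Ω →ₗ.[ℝ] NonlocalRobin.L2 Ω,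
        NonlocalRobin.IsAssociatedOperator D a A ∧
        IsSelfAdjoint A ∧
        ∀ u f : NonlocalRobin.L2 Ω, (u, f) ∈ A.graph ↔
          NonlocalRobin.IsWeakRobinSolution s Ω β f (NonlocalRobin.robinExt s Ω β u) := by
  have hΩm := hΩ.measurableSet
  have hb : volume Ω ≠ ⊤ := hΩb.measure_lt_top.ne
  have hfr := hΩL.volume_frontier_eq_zero
  set a := NonlocalRobin.robinForm hs0 hΩm hb hfr hβ
  have hsymm : ∀ u v, a u v = a v u := fun u v => NonlocalRobin.robinEnergy_comm _ _
  have hnn : ∀ u, 0 ≤ a u u := fun u => NonlocalRobin.robinEnergy_self_nonneg hs0 hs1 hβ0 _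
  have hD := NonlocalRobin.dense_robinDomain (hs0 := hs0) (hΩ := hΩm) (hb := hb) (hfr := hfr)
    hn hs1 hβ hβ0
  have hclosed : NonlocalRobin.IsClosedForm _ a :=
    NonlocalRobin.isClosedForm_robinForm hs1 hβ hβ0
  refine ⟨NonlocalRobin.robinDomain hs0 hΩm hb hfr hβ, a, fun u => Iff.rfl, fun u v => rfl,
    hsymm, hnn, hD, hclosed, fun u => ?_, NonlocalRobin.formOperator _ a,
    NonlocalRobin.isAssociatedOperator_formOperator hD,
    NonlocalRobin.isSelfAdjoint_formOperator hsymm hnn hD hclosed, fun u f => ?_⟩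
  · have hsub : (closure Ω)ᶜ ⊆ Ωᶜ := Set.compl_subset_compl.2 subset_closure
    filter_upwards [ae_restrict_of_ae_restrict_of_subset hsub hβ0,
      ae_restrict_mem isClosed_closure.measurableSet.compl] with x hβx hx
    exact NonlocalRobin.nonlocalNormalDeriv_robinExt_add hs0 hs1 hΩm hb
      (NonlocalRobin.integrableOn_fun hb u) hx hβx
  · rw [NonlocalRobin.isAssociatedOperator_formOperator hD u f]
    exact NonlocalRobin.exists_robinForm_eq_iff_isWeakRobinSolution hs1 hβ hβ0 u f
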